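/- Let $\mathbb N$ denote the positive integers. Let $G$ be a group generated by a finite set $X$, let $F(X)$ be the free group on $X$, and for $k\in\mathbb N$ let $\mathcal S_k\subseteq F(X)$ be the set of (elements of $F(X)$ given by) words of length at most $k$ in the alphabet $X\cup X^{-1}$ that represent $1$ in $G$. For $\mathcal R\subseteq F(X)$, let $\langle\langle\mathcal R\rangle\rangle$ be its normal closure, and for $w\in\langle\langle\mathcal R\rangle\rangle$ let $\mathrm{Area}_{\mathcal R}(w)$ be the least $\ell\ge 0$ such that $w=\prod_{i=1}^{\ell}f_i^{-1}R_i^{\varepsilon_i}f_i$ in $F(X)$ with $f_i\in F(X)$, $R_i\in\mathcal R$, $\varepsilon_i=\pm1$. The isoperimetric spectrum of $G$ with respect to $X$ is the function $$f_{G,X}(k,m,n)=\max\{\mathrm{Area}_{\mathcal S_m}(w)\mid w\in\langle\langle\mathcal S_k\rangle\rangle,\ \|w\|\le n\},\qquad (k,m,n)\in\mathbb N^3,\ m\ge k,$$ where $\|w\|$ is the length of the word $w$. For real functions $f,g$ of such triples, write $f\preccurlyeq g$ if there is $C\in\mathbb N$ such that $$f(k,Cm,n)\le C\,g(Ck,m,Cn)+C\frac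 nm+C\quad\text{for all }(k,m,n)\in\mathbb N^3\text{ with }m\ge Ck,$$ and $f\sim g$ if $f\preccurlyeq g$ and $g\preccurlyeq f$. A group is hyperbolic if, for some finite generating set $Y$, there is $\delta\ge0$ such that in its Cayley graph with respect to $Y$ (with edges of length $1$) each side of every geodesic triangle lies in the union of the closed $\delta$-neighbourhoods of the other two sides. Let $G$ be a finitely presented group and let $X$ be any finite generating set of $G$. Then: 1. $G$ is hyperbolic if and only if its isoperimetric spectrum is linear, that is, $f_{G,X}(k,m,n)\sim n/m$. 2. More generally, there exists a function $\alpha\colon\mathbb N\to\mathbb N\cup\{0\}$ such that $f_{G,X}(k,m,n)\sim\alpha(n)/m$ if and only if $G$ is hyperbolic. -/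

import Mathlib

/-! ### Words, relators and area -/

/-- The natural homomorphism from the free group `F(X)` onto the subgroup of `G` generated by `X`. -/
def wordEval {G : Type*} [Group G] (X : Set G) : FreeGroup X →* G :=
  FreeGroup.lift (fun x : X => (x : G))

/-- `S_k`: the set of elements of `F(X)` given by words (finite lists of letters from `X ∪ X⁻¹`,
possibly non-reduced) of length at most `k` that represent `1` in `G`. -/
def shortRelators {G : Type*} [Group G] (X : Set G) (k : ℕ) : Set (FreeGroup X) :=
  {r | ∃ L : List (X × Bool), L.length ≤ k ∧ FreeGroup.mk L = r ∧ wordEval X r = 1}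

/-- `g` is a product of exactly `l` factors of the form `f⁻¹ * R ^ (±1) * f` with `R ∈ 𝓡`. -/
def IsProdOfConj {F : Type*} [Group F] (𝓡 : Set F) (l : ℕ) (g : F) : Prop :=
  ∃ P : List F, P.length = l ∧ P.prod = g ∧
    ∀ p ∈ P, ∃ f : F, ∃ R ∈ 𝓡, p = f⁻¹ * R * f ∨ p = f⁻¹ * R⁻¹ * f

/-- `Area_𝓡(g)`: the least number of factors in a decomposition of `g` into a product of conjugates
of elements of `𝓡` and their inverses. It is meaningful for `g` in the normal closure of `𝓡`. -/
noncomputable def relArea {F : Type*} [Group F] (𝓡 : Set F) (g : F) : ℕ :=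
  sInf {l | IsProdOfConj 𝓡 l g}

/-- The areas over which the isoperimetric spectrum takes the maximum: all `Area_{S_m}(w)`, where
`w` is a word of length at most `n` that lies in the normal closure of `S_k`. -/
def areaSet {G : Type*} [Group G] (X : Set G) (k m n : ℕ) : Set ℕ :=
  {a | ∃ L : List (X × Bool), L.length ≤ n ∧
    FreeGroup.mk L ∈ Subgroup.normalClosure (shortRelators X k) ∧
    a = relArea (shortRelators X m) (FreeGroup.mk L)}

/-- The isoperimetric spectrum `f_{G,X}(k, m, n)` (meaningful for `1 ≤ k ≤ m`, `1 ≤ n`). For finite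
`X` the supremum is a maximum, see `isoSpectrum_isGreatest`. -/
noncomputable def isoSpectrum {G : Type*} [Group G] (X : Set G) (k m n : ℕ) : ℝ :=
  ((sSup (areaSet X k m n) : ℕ) : ℝ)

/-- Elements of the normal closure do admit a decomposition, so that their area is a minimum over a
nonempty set. -/
theorem exists_isProdOfConj {F : Type*} [Group F] {𝓡 : Set F} {g : F}
    (hg : g ∈ Subgroup.normalClosure 𝓡) : ∃ l, IsProdOfConj 𝓡 l g := by
  have hg' : g ∈ Subgroup.closure (Group.conjugatesOfSet 𝓡) := hg
  induction hg' using Subgroup.closure_induction_left with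
  | one => exact ⟨0, [], rfl, rfl, by simp⟩
  | mul_left x hx y hy ih =>
    obtain ⟨l, P, hl, hP, h⟩ := ih hy
    obtain ⟨R, hR, hc⟩ := Group.mem_conjugatesOfSet_iff.1 hx
    obtain ⟨c, hc⟩ := isConj_iff.1 hc
    refine ⟨l + 1, x :: P, by simp [hl], by simp [hP], ?_⟩
    intro p hp
    rcases List.mem_cons.1 hp with rfl | hp
    · exact ⟨c⁻¹, R, hR, Or.inl (by simp [← hc])⟩
    · exact h p hp
  | inv_mul_cancel x hx y hy ih =>
    obtain ⟨l, P, hl, hP, h⟩ := ih hy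
    obtain ⟨R, hR, hc⟩ := Group.mem_conjugatesOfSet_iff.1 hx
    obtain ⟨c, hc⟩ := isConj_iff.1 hc
    refine ⟨l + 1, x⁻¹ :: P, by simp [hl], by simp [hP], ?_⟩
    intro p hp
    rcases List.mem_cons.1 hp with rfl | hp
    · exact ⟨c⁻¹, R, hR, Or.inr (by simp [← hc, mul_assoc])⟩
    · exact h p hp

theorem shortRelators_mono {G : Type*} [Group G] (X : Set G) {k m : ℕ} (hkm : k ≤ m) :
    shortRelators X k ⊆ shortRelators X m := by
  rintro r ⟨L, hL, h⟩
  exact ⟨L, hL.trans hkm, h⟩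

/-- For `k ≤ m` all the areas entering the definition of the spectrum are attained minima. -/
theorem isProdOfConj_relArea {G : Type*} [Group G] (X : Set G) {k m : ℕ} (hkm : k ≤ m)
    {w : FreeGroup X} (hw : w ∈ Subgroup.normalClosure (shortRelators X k)) :
    IsProdOfConj (shortRelators X m) (relArea (shortRelators X m) w) w :=
  Nat.sInf_mem (exists_isProdOfConj
    (Subgroup.normalClosure_mono (shortRelators_mono X hkm) hw))

/-- For a finite set `X` the supremum in the definition of the spectrum is a maximum. -/
theorem isoSpectrum_isGreatest {G : Type*} [Group G] {X : Set G} (hX : X.Finite) (k m n : ℕ) :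
    IsGreatest (areaSet X k m n) (sSup (areaSet X k m n)) := by
  have : Finite X := hX
  have hfin : (areaSet X k m n).Finite := by
    refine ((List.finite_length_le (X × Bool) n).image
      (fun L => relArea (shortRelators X m) (FreeGroup.mk L))).subset ?_
    rintro a ⟨L, hL, -, rfl⟩
    exact ⟨L, hL, rfl⟩
  have hne : (areaSet X k m n).Nonempty :=
    ⟨_, [], Nat.zero_le n, one_mem _, rfl⟩
  exact ⟨Nat.sSup_mem hne hfin.bddAbove, fun a ha => le_csSup hfin.bddAbove ha⟩

/-! ### Comparison of spectra -/

/-- `f ≼ g` for functions of triples `(k, m, n)` of positive integers with `m ≥ k`: for some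
positive integer `C`, `f(k, Cm, n) ≤ C g(Ck, m, Cn) + C n / m + C` whenever `m ≥ Ck`. -/
def SpecLE (f g : ℕ → ℕ → ℕ → ℝ) : Prop :=
  ∃ C : ℕ, 1 ≤ C ∧ ∀ k m n : ℕ, 1 ≤ k → 1 ≤ n → C * k ≤ m →
    f k (C * m) n ≤ C * g (C * k) m (C * n) + C * ((n : ℝ) / m) + C

/-- `f ∼ g`. -/
def SpecEquiv (f g : ℕ → ℕ → ℕ → ℝ) : Prop :=
  SpecLE f g ∧ SpecLE g f

/-! ### The Cayley graph as a metric space -/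

/-- Points of the Cayley graph of `G` with respect to a generating set `X`: the vertices are the
elements of `G`, and for every `g : G` and `s ∈ X` there is an edge from `g` to `g * s`, identified
with `[0, 1]`; `edge g s t` is the point at distance `t` from `g` along that edge. The end points of
edges are further names for vertices (at distance `0` from `vertex g`). -/
inductive CayleyPoint {G : Type*} [Group G] (X : Set G) (hX : Subgroup.closure X = ⊤) : Type _
  | vertex (g : G) : CayleyPoint X hX
  | edge (g : G) (s : X) (t : unitInterval) : CayleyPoint X hX

namespace CayleyPoint

variable {G : Type*} [Group G] {X : Set G} {hX : Subgroup.closure X = ⊤}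

/-- `p.Exit v c`: one reaches the vertex `v` from `p` by a walk of length `c` inside the (vertex or)
edge containing `p`. -/
inductive Exit : CayleyPoint X hX → G → ℝ → Prop
  | vertex (g : G) : Exit (.vertex g) g 0
  | source (g : G) (s : X) (t : unitInterval) : Exit (.edge g s t) g t
  | target (g : G) (s : X) (t : unitInterval) : Exit (.edge g s t) (g * s) (1 - t)

/-- Lengths of routes from `p` to `q`: either inside one edge, or by leaving towards a vertex `u`,
going to a vertex `v` along a shortest edge path, and reaching `q` from `v`. -/
inductive Route : CayleyPoint X hX → CayleyPoint X hX → ℝ → Prop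
  | inside (g : G) (s : X) (t t' : unitInterval) :
      Route (.edge g s t) (.edge g s t') |(t : ℝ) - t'|
  | through {p q : CayleyPoint X hX} {u v : G} {c c' : ℝ} (hp : Exit p u c) (hq : Exit q v c') :
      Route p q (c + (SimpleGraph.mulCayley X).dist u v + c')

theorem Exit.nonneg {p : CayleyPoint X hX} {u : G} {c : ℝ} (h : Exit p u c) : 0 ≤ c := by
  cases h with
  | vertex => exact le_rfl
  | source g s t => exact t.2.1
  | target g s t => have := t.2.2; linarith

theorem Route.nonneg {p q : CayleyPoint X hX} {a : ℝ} (h : Route p q a) : 0 ≤ a := by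
  cases h with
  | inside => exact abs_nonneg _
  | through hp hq => have := hp.nonneg; have := hq.nonneg; positivity

theorem Route.symm {p q : CayleyPoint X hX} {a : ℝ} (h : Route p q a) : Route q p a := by
  cases h with
  | inside g s t t' => rw [abs_sub_comm]; exact .inside g s t' t
  | through hp hq =>
    rw [SimpleGraph.dist_comm, add_comm, ← add_assoc, add_right_comm]
    exact .through hq hp

/-- The Cayley graph with respect to a generating set is connected. -/
theorem connected (hX : Subgroup.closure X = ⊤) : (SimpleGraph.mulCayley X).Connected := by
  have step : ∀ (g : G), ∀ s ∈ X, (SimpleGraph.mulCayley X).Reachable g (g * s) := by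
    intro g s hs
    by_cases h : g = g * s
    · rw [← h]
    · exact SimpleGraph.Adj.reachable
        ((SimpleGraph.mulCayley_adj' X g (g * s)).2 ⟨h, s, hs, Or.inl rfl⟩)
  have key : ∀ x : G, ∀ g : G, (SimpleGraph.mulCayley X).Reachable g (g * x) := by
    intro x
    have hx : x ∈ Subgroup.closure X := by rw [hX]; trivial
    induction hx using Subgroup.closure_induction with
    | mem s hs => exact fun g => step g s hs
    | one => intro g; simp
    | mul x y _ _ h1 h2 =>
      intro g
      rw [← mul_assoc]
      exact (h1 g).trans (h2 _)
    | inv x _ h =>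
      intro g
      have := h (g * x⁻¹)
      rw [inv_mul_cancel_right] at this
      exact this.symm
  have : Nonempty G := ⟨1⟩
  refine SimpleGraph.Connected.mk fun u v => ?_
  have := key (u⁻¹ * v) u
  rwa [mul_inv_cancel_left] at this

theorem dist_edge_le_one (g : G) (s : X) : (SimpleGraph.mulCayley X).dist g (g * s) ≤ 1 := by
  by_cases h : g = g * s
  · rw [← h]; simp
  · exact (SimpleGraph.dist_eq_one_iff_adj.2
      ((SimpleGraph.mulCayley_adj' X g (g * s)).2 ⟨h, s, s.2, Or.inl rfl⟩)).le

theorem exists_exit (p : CayleyPoint X hX) : ∃ u c, Exit p u c := by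
  cases p with
  | vertex g => exact ⟨g, 0, .vertex g⟩
  | edge g s t => exact ⟨g, t, .source g s t⟩

theorem Exit.dist_le {p : CayleyPoint X hX} {u v : G} {c c' : ℝ} (h : Exit p u c)
    (h' : Exit p v c') : ((SimpleGraph.mulCayley X).dist u v : ℝ) ≤ c + c' := by
  cases h with
  | vertex g => cases h'; simp
  | source g s t =>
    have h0 := t.2.1
    have h1 : ∀ g : G, ((SimpleGraph.mulCayley X).dist g (g * s) : ℝ) ≤ 1 := fun g => by
      exact_mod_cast dist_edge_le_one g s
    cases h' with
    | source => simpa using h0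
    | target => linarith [h1 u]
  | target g s t =>
    have h0 := t.2.2
    have h1 : ((SimpleGraph.mulCayley X).dist g (g * s) : ℝ) ≤ 1 := by
      exact_mod_cast dist_edge_le_one g s
    cases h' with
    | source => rw [SimpleGraph.dist_comm]; linarith
    | target => simp; linarith

theorem Exit.shift {g : G} {s : X} {t t' : unitInterval} {u : G} {c : ℝ}
    (h : Exit (.edge g s t : CayleyPoint X hX) u c) :
    ∃ c', Exit (.edge g s t' : CayleyPoint X hX) u c' ∧ c' ≤ |(t : ℝ) - t'| + c := by
  cases h with
  | source =>
    exact ⟨t', .source g s t', by linarith [neg_abs_le ((t : ℝ) - t')]⟩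
  | target =>
    exact ⟨1 - t', .target g s t', by linarith [le_abs_self ((t : ℝ) - t')]⟩

theorem Route.comp {p q r : CayleyPoint X hX} {a b : ℝ} (h : Route p q a) (h' : Route q r b) :
    ∃ c, Route p r c ∧ c ≤ a + b := by
  cases h with
  | inside g s t t' =>
    cases h' with
    | inside _ _ _ t'' => exact ⟨_, .inside g s t t'', abs_sub_le _ _ _⟩
    | through hp hq =>
      obtain ⟨c', hc', hle⟩ := hp.shift (t' := t)
      refine ⟨_, .through hc' hq, ?_⟩
      rw [abs_sub_comm] at hle
      linarith
  | through hp hq =>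
    cases h' with
    | inside g s t t' =>
      obtain ⟨c', hc', hle⟩ := hq.shift (t' := t')
      exact ⟨_, .through hp hc', by linarith⟩
    | through hp' hq' =>
      rename_i u v c c' u' v' d d'
      refine ⟨_, .through hp hq', ?_⟩
      have h1 := hq.dist_le hp'
      have h2 : ((SimpleGraph.mulCayley X).dist u v' : ℝ) ≤
          (SimpleGraph.mulCayley X).dist u v + (SimpleGraph.mulCayley X).dist v u' +
            (SimpleGraph.mulCayley X).dist u' v' := by
        have e1 := (connected hX).dist_triangle (u := u) (v := v) (w := v')
        have e2 := (connected hX).dist_triangle (u := v) (v := u') (w := v')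
        exact_mod_cast (by omega)
      linarith

theorem bddBelow_route (p q : CayleyPoint X hX) : BddBelow {a | Route p q a} :=
  ⟨0, fun _ h => h.nonneg⟩

theorem route_nonempty (p q : CayleyPoint X hX) : {a | Route p q a}.Nonempty := by
  obtain ⟨u, c, h⟩ := exists_exit p
  obtain ⟨v, c', h'⟩ := exists_exit q
  exact ⟨_, .through h h'⟩

/-- The path metric on the Cayley graph, in which every edge has length `1`: the distance is the
length of a shortest route. -/
noncomputable instance instPseudoMetricSpace : PseudoMetricSpace (CayleyPoint X hX) where
  dist p q := sInf {a | Route p q a}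
  dist_self p := by
    refine le_antisymm (csInf_le (bddBelow_route p p) ?_) (Real.sInf_nonneg fun _ h => h.nonneg)
    cases p with
    | vertex g => simpa using Route.through (Exit.vertex (hX := hX) g) (Exit.vertex g)
    | edge g s t => simpa using Route.inside (hX := hX) g s t t
  dist_comm p q := by
    congr 1
    ext a
    exact ⟨Route.symm, Route.symm⟩
  dist_triangle p q r := by
    refine le_of_forall_pos_le_add fun ε hε => ?_
    obtain ⟨a, ha, ha'⟩ := exists_lt_of_csInf_lt (route_nonempty p q)
      (lt_add_of_pos_right _ (half_pos hε))
    obtain ⟨b, hb, hb'⟩ := exists_lt_of_csInf_lt (route_nonempty q r)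
      (lt_add_of_pos_right _ (half_pos hε))
    obtain ⟨c, hc, hle⟩ := Route.comp ha hb
    have := csInf_le (bddBelow_route p r) hc
    linarith

/-- Between vertices this metric is the word metric. -/
theorem dist_vertex (g h : G) :
    dist (.vertex g : CayleyPoint X hX) (.vertex h) = (SimpleGraph.mulCayley X).dist g h := by
  change sInf {a | Route (.vertex g : CayleyPoint X hX) (.vertex h) a} = _
  have : {a | Route (.vertex g : CayleyPoint X hX) (.vertex h) a} =
      {((SimpleGraph.mulCayley X).dist g h : ℝ)} := by
    ext a
    constructor
    · intro ha
      cases ha with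
      | through hp hq => cases hp; cases hq; simp
    · rintro rfl
      simpa using Route.through (Exit.vertex (hX := hX) g) (Exit.vertex h)
  rw [this, csInf_singleton]

end CayleyPoint

/-! ### Hyperbolicity -/

/-- `A` is a geodesic segment from `x` to `y`: the image of an isometric embedding of an interval
`[0, ℓ]` that takes `0` to `x` and `ℓ` to `y`. -/
def IsGeodesicSegment {S : Type*} [PseudoMetricSpace S] (A : Set S) (x y : S) : Prop :=
  ∃ (ℓ : ℝ) (γ : ℝ → S), 0 ≤ ℓ ∧ γ 0 = x ∧ γ ℓ = y ∧
    (∀ s ∈ Set.Icc 0 ℓ, ∀ t ∈ Set.Icc 0 ℓ, dist (γ s) (γ t) = |s - t|) ∧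
    A = γ '' Set.Icc 0 ℓ

/-- Every geodesic triangle in `S` is `δ`-thin: each side lies in the union of the closed
`δ`-neighbourhoods of the other two. (Stated for one side; rename the corners for the others.) -/
def IsDeltaHyperbolic (S : Type*) [PseudoMetricSpace S] (δ : ℝ) : Prop :=
  ∀ (x y z : S) (A B C : Set S),
    IsGeodesicSegment A x y → IsGeodesicSegment B y z → IsGeodesicSegment C z x →
    ∀ p ∈ A, ∃ q ∈ B ∪ C, dist p q ≤ δ

/-- `G` is hyperbolic: its Cayley graph with respect to some finite generating set is
`δ`-hyperbolic for some `δ ≥ 0`. -/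
def IsHyperbolicGroup (G : Type*) [Group G] : Prop :=
  ∃ (Y : Set G) (hY : Subgroup.closure Y = ⊤), Y.Finite ∧
    ∃ δ : ℝ, 0 ≤ δ ∧ IsDeltaHyperbolic (CayleyPoint Y hY) δ

/-!
Both directions pass through Gromov's four-point condition for the word metric of `G`, a metric with
values in `ℕ`.

If `G` is hyperbolic, consider a closed path of length at least `4 L` in its Cayley graph, and a
vertex `x` of the path that is farthest from the base point. The four-point condition, applied to
`x`, the base point and the vertices `L` steps before and after `x`, shows that these two vertices
are at distance at most `L + δ`. So one relator of length `O(L)` shortens the path by `L - δ`, and a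
word of length `n` representing `1` has area `O(n / L + 1)`, uniformly in `L`
(`FourPoint.exists_isProdOfConj`). Changing the generating set costs one more relator for every
subword of length `L` (`exists_isProdOfConj_mul_map`).

Conversely, suppose that the spectrum is equivalent to `α(n) / m`. Words of length `n` have area at
most `1` with respect to relators of length `n`, so that `α` grows at most linearly, and for a fixed
large `m` the spectrum is an ordinary linear isoperimetric function of a finite presentation.
Instead of van Kampen diagrams, the argument uses the integral of `φ dh` along paths, for
`1`-Lipschitz functions `φ` and `h` on the group: it is bounded on relators, so that around a loop
it is bounded by a multiple of the area (`IsWordIntegral.abs_le_area`), and hence of the length.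
If `p` lies on a geodesic from `a` to `b` and `φ` is a bump of height `D` at `p`, while `h` is the
distance to `a`, then the integral along the geodesic is `D²`. Hence a path from `b` to `a` that
avoids the ball of radius `D` around `p` has length at least of order `D²`
(`LinearStokes.separation`). So triangles of size `N` are `O(√N)`-thin. Finally, if they are
`(D + 1)`-thin for a large `D`, but some vertex of a side is farther than `D` from the other sides,
then these sides contain points near it that can be joined by a path of length `O(D)` outside its
`D`-ball, which is impossible. So thinness descends to a constant independent of `N`
(`LinearStokes.thinUpTo`), and thin triangles give the four-point condition
(`fourPoint_of_thin`).
-/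

/-! ### Discrete geodesic metrics and integrals of `φ dh` -/

/-- The axioms of the vertex metric of a connected graph: a metric with values in `ℕ` such that
between any two points there is a point at each intermediate distance. -/
structure IsDiscreteGeodesic {V : Type*} (d : V → V → ℕ) : Prop where
  self : ∀ x, d x x = 0
  eq_of_zero : ∀ x y, d x y = 0 → x = y
  symm : ∀ x y, d x y = d y x
  triangle : ∀ x y z, d x z ≤ d x y + d y z
  between : ∀ x y k, k ≤ d x y → ∃ v, d x v = k ∧ d v y = d x y - k

/-- `v` lies on some geodesic from `x` to `y`. -/
def Between {V : Type*} (d : V → V → ℕ) (x y v : V) : Prop := d x v + d v y = d x y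

/-- Gromov's four-point condition, in additive form. -/
def FourPoint {V : Type*} (d : V → V → ℕ) (δ : ℕ) : Prop :=
  ∀ x y z p, d x p + d y z ≤ max (d x y + d z p) (d x z + d y p) + δ

/-- Geodesic triangles with sides of length at most `N` are `D`-thin, geodesics being replaced by
the intervals they sweep out. -/
def ThinUpTo {V : Type*} (d : V → V → ℕ) (N D : ℕ) : Prop :=
  ∀ x y z, d x y ≤ N → d y z ≤ N → d x z ≤ N → ∀ p, Between d x y p →
    ∃ q, (Between d x z q ∨ Between d y z q) ∧ d p q ≤ D

/-- `WalkIn d P a b n`: there is a walk from `a` to `b` of at most `n` steps, all of whose vertices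
satisfy `P`. -/
inductive WalkIn {V : Type*} (d : V → V → ℕ) (P : V → Prop) : V → V → ℕ → Prop
  | nil {a : V} (n : ℕ) (ha : P a) : WalkIn d P a a n
  | cons {a b c : V} {n : ℕ} (ha : P a) (hab : d a b ≤ 1) (h : WalkIn d P b c n) :
      WalkIn d P a c (n + 1)

/-- `WalkInt d φ h a b n s`: there is a walk from `a` to `b` of at most `n` steps, along which the
trapezoidal sums of the differential `2 φ dh` add up to `s`. -/
inductive WalkInt {V : Type*} (d : V → V → ℕ) (φ h : V → ℤ) : V → V → ℕ → ℤ → Prop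
  | nil (a : V) (n : ℕ) : WalkInt d φ h a a n 0
  | cons {a b c : V} {n : ℕ} {s : ℤ} (hab : d a b ≤ 1) (w : WalkInt d φ h b c n s) :
      WalkInt d φ h a c (n + 1) ((φ a + φ b) * (h b - h a) + s)

/-- An integer valued function that is `1`-Lipschitz for `d`. -/
def IsLip {V : Type*} (d : V → V → ℕ) (φ : V → ℤ) : Prop := ∀ u v, φ u ≤ φ v + d u v

/-- For `1`-Lipschitz functions, the integral of `φ dh` around a closed walk is bounded by a
multiple of the length of the walk. -/
def LinearStokes {V : Type*} (d : V → V → ℕ) (K : ℕ) : Prop :=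
  ∀ φ h : V → ℤ, IsLip d φ → IsLip d h → ∀ a n s, WalkInt d φ h a a n s → |s| ≤ K * (n + 1)

namespace WalkInt

variable {V : Type*} {d : V → V → ℕ} {φ h : V → ℤ}

theorem mono {a b : V} {n m : ℕ} {s : ℤ} (w : WalkInt d φ h a b n s) (hnm : n ≤ m) :
    WalkInt d φ h a b m s := by
  induction w generalizing m with
  | nil a n => exact .nil _ _
  | cons hab w ih =>
    obtain ⟨m, rfl⟩ : ∃ k, m = k + 1 := ⟨m - 1, by omega⟩
    exact .cons hab (ih (by omega))

theorem append {a b c : V} {n m : ℕ} {s t : ℤ} (w : WalkInt d φ h a b n s)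
    (w' : WalkInt d φ h b c m t) : WalkInt d φ h a c (n + m) (s + t) := by
  induction w with
  | nil a n => rw [zero_add]; exact w'.mono (by omega)
  | cons hab w ih =>
    rw [add_assoc (_ * _), Nat.add_right_comm]
    exact .cons hab (ih w')

end WalkInt

namespace WalkIn

variable {V : Type*} {d : V → V → ℕ} {P : V → Prop}

theorem mono {a b : V} {n m : ℕ} (w : WalkIn d P a b n) (h : n ≤ m) : WalkIn d P a b m := by
  induction w generalizing m with
  | nil n ha => exact .nil _ ha
  | cons ha hab w ih =>
    obtain ⟨m, rfl⟩ : ∃ k, m = k + 1 := ⟨m - 1, by omega⟩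
    exact .cons ha hab (ih (by omega))

theorem append {a b c : V} {n m : ℕ} (w : WalkIn d P a b n) (w' : WalkIn d P b c m) :
    WalkIn d P a c (n + m) := by
  induction w with
  | nil n ha => exact w'.mono (by omega)
  | cons ha hab w ih =>
    rw [Nat.add_right_comm]
    exact .cons ha hab (ih w')

theorem prop_left {a b : V} {n : ℕ} (w : WalkIn d P a b n) : P a := by
  cases w <;> assumption

theorem symm (hd : IsDiscreteGeodesic d) {a b : V} {n : ℕ} (w : WalkIn d P a b n) :
    WalkIn d P b a n := by
  induction w with
  | nil n ha => exact .nil _ ha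
  | cons ha hab w ih =>
    exact ih.append (.cons w.prop_left (by rw [hd.symm]; exact hab) (.nil 0 ha))

/-- The integral of `φ dh` vanishes along a walk that avoids the support of `φ`. -/
theorem walkInt {a b : V} {n : ℕ} (w : WalkIn d P a b n) {φ : V → ℤ} (h : V → ℤ)
    (hφ : ∀ v, P v → φ v = 0) : WalkInt d φ h a b n 0 := by
  induction w with
  | nil n ha => exact .nil _ _
  | cons ha hab w ih =>
    have := WalkInt.cons (a := _) hab ih
    rwa [hφ _ ha, hφ _ w.prop_left, add_zero, add_zero, zero_mul] at this

end WalkIn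

namespace IsDiscreteGeodesic

variable {V : Type*} {d : V → V → ℕ}

/-- A geodesic is a walk; it stays in the interval between its end points. -/
theorem walkIn (hd : IsDiscreteGeodesic d) {P : V → Prop} {n : ℕ} (a b : V) (hn : d a b ≤ n)
    (hP : ∀ v, Between d a b v → P v) : WalkIn d P a b n := by
  induction n generalizing a with
  | zero =>
    obtain rfl := hd.eq_of_zero a b (by omega)
    exact .nil 0 (hP a (by simp [Between, hd.self]))
  | succ n ih =>
    by_cases h0 : d a b = 0
    · obtain rfl := hd.eq_of_zero a b h0
      exact .nil _ (hP a (by simp [Between, hd.self]))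
    · obtain ⟨v, hv, hv'⟩ := hd.between a b 1 (by omega)
      refine .cons (hP a (by simp [Between, hd.self])) hv.le (ih v (by omega) fun u hu => hP u ?_)
      have h1 := hd.triangle a v u
      have h2 := hd.triangle a u b
      simp only [Between] at hu ⊢
      omega

end IsDiscreteGeodesic

/-! ### Thin triangles from bounds on integrals -/

section Separation

variable {V : Type*} {d : V → V → ℕ}

/-- If `p` lies on a geodesic from `a` to `b`, then a walk from `b` to `a` that avoids the ball of
radius `D` around `p` has length at least of order `D²`: integrate `φ dh` with `φ` a bump of height
`D` at `p` and `h` the distance to `a`. -/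
theorem LinearStokes.separation (hd : IsDiscreteGeodesic d) {K : ℕ} (hK : LinearStokes d K)
    {a b p : V} (hp : Between d a b p) {D N : ℕ} (w : WalkIn d (fun v => D ≤ d p v) b a N) :
    2 * D ^ 2 ≤ K * (d a b + N + 1) := by
  set φ : V → ℤ := fun v => max 0 (D - d p v) with hφ
  set h : V → ℤ := fun v => d a v with hh
  have hφL : IsLip d φ := by
    intro u v
    have h1 := hd.triangle p u v
    simp only [hφ]
    omega
  have hhL : IsLip d h := by
    intro u v
    have h1 := hd.triangle a v u
    rw [hd.symm v u] at h1
    simp only [hh]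
    omega
  -- Before `p` the integrand is the increment of `φ²`, after `p` it is the decrement.
  have before : ∀ k v, d v p = k → d a v + d v p + d p b = d a b →
      WalkInt d φ h v p k (φ p ^ 2 - φ v ^ 2) := by
    intro k
    induction k with
    | zero =>
      intro v hv _
      obtain rfl := hd.eq_of_zero _ _ hv
      rw [sub_self]
      exact .nil _ _
    | succ k ih =>
      intro v hv hv'
      obtain ⟨u, hu, hu'⟩ := hd.between v p 1 (by omega)
      have t1 := hd.triangle a v u
      have t2 := hd.triangle a u b
      have t3 := hd.triangle u p b
      have key := WalkInt.cons hu.le (ih u (by omega) (by omega))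
      have e1 : h u - h v = 1 := by simp only [hh]; omega
      have e2 : φ u = φ v + 1 ∨ φ u = 0 ∧ φ v = 0 := by
        have s1 := hd.symm u p
        have s2 := hd.symm v p
        simp only [hφ]
        omega
      convert key using 1
      rw [e1]
      rcases e2 with e2 | ⟨e2, e3⟩
      · rw [e2]; ring
      · rw [e2, e3]; ring
  have after : ∀ k v, d v b = k → d a p + d p v + d v b = d a b →
      WalkInt d φ h v b k (φ v ^ 2 - φ b ^ 2) := by
    intro k
    induction k with
    | zero =>
      intro v hv _
      obtain rfl := hd.eq_of_zero _ _ hv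
      rw [sub_self]
      exact .nil _ _
    | succ k ih =>
      intro v hv hv'
      obtain ⟨u, hu, hu'⟩ := hd.between v b 1 (by omega)
      have t1 := hd.triangle a v u
      have t2 := hd.triangle a u b
      have t3 := hd.triangle p v u
      have t4 := hd.triangle a p u
      have t5 := hd.triangle a p v
      have key := WalkInt.cons hu.le (ih u (by omega) (by omega))
      have e1 : h u - h v = 1 := by simp only [hh]; omega
      have e2 : φ v = φ u + 1 ∨ φ u = 0 ∧ φ v = 0 := by
        simp only [hφ]
        omega
      convert key using 1
      rw [e1]
      rcases e2 with e2 | ⟨e2, e3⟩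
      · rw [e2]; ring
      · rw [e2, e3]; ring
  simp only [Between] at hp
  have hz : ∀ v, D ≤ d p v → φ v = 0 := by
    intro v hv
    simp only [hφ]
    omega
  have loop := ((before _ a rfl (by rw [hd.self]; omega)).append
    (after _ p rfl (by rw [hd.self]; omega))).append (w.walkInt h hz)
  have hb : φ b = 0 := hz b w.prop_left
  have ha : φ a = 0 := hz a (w.symm hd).prop_left
  have hpp : φ p = D := by simp [hφ, hd.self]
  have := hK φ h hφL hhL _ _ _ loop
  rw [hb, ha, hpp, hp] at this
  have := (le_abs_self _).trans this
  push_cast at this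
  zify
  linarith

end Separation

section Bootstrap

variable {V : Type*} {d : V → V → ℕ}

theorem LinearStokes.thinUpTo_of_lt (hd : IsDiscreteGeodesic d) {K : ℕ} (hK : LinearStokes d K)
    {N D : ℕ} (h : K * (3 * N + 1) < 2 * D ^ 2) : ThinUpTo d N D := by
  intro x y z hxy hyz hxz p hp
  by_contra! hc
  have w : WalkIn d (fun v => D ≤ d p v) y x (N + N) :=
    (hd.walkIn y z hyz fun v hv => (hc v (.inr hv)).le).append
      ((hd.walkIn x z hxz fun v hv => (hc v (.inl hv)).le).symm hd)
  have h1 := hK.separation hd hp w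
  have h2 : K * (d x y + (N + N) + 1) ≤ K * (3 * N + 1) := Nat.mul_le_mul_left _ (by omega)
  omega

/-- Points `a` and `b` of two sides that meet at `z`, if they are close to each other and to `p`, can
be joined outside the ball of radius `D` around `p` by a walk of length `O(D)`: follow the side of
`a` towards `z` until far away from `p`, where the sides are still close to each other, and come
back along the side of `b`. -/
theorem ThinUpTo.hinge (hd : IsDiscreteGeodesic d) {N D : ℕ} (hT : ThinUpTo d N D)
    {p z a b : V} (haz : d a z ≤ N) (hbz : d b z ≤ N) (hN : 6 * D ≤ N)
    (hab : d a b ≤ 6 * D) (hpa : d p a ≤ 3 * D)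
    (ha : ∀ v, Between d a z v → D ≤ d p v) (hb : ∀ v, Between d b z v → D ≤ d p v) :
    WalkIn d (fun v => D ≤ d p v) a b (24 * D) := by
  have s1 := hd.symm b a
  by_cases hs : d a z ≤ 8 * D
  · have t1 := hd.triangle b a z
    exact ((hd.walkIn a z le_rfl ha).append ((hd.walkIn b z le_rfl hb).symm hd)).mono (by omega)
  · obtain ⟨u, hu, hu'⟩ := hd.between a z (8 * D) (by omega)
    have hau : Between d a z u := by simp only [Between]; omega
    obtain ⟨q, hq | hq, hqu⟩ := hT a z b haz (by rw [hd.symm]; exact hbz) (by omega) u hau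
    · -- `u` is too far from `a` to be close to a geodesic from `a` to `b`.
      simp only [Between] at hq
      have t1 := hd.triangle a q u
      have s2 := hd.symm u q
      have hD : D = 0 := by omega
      subst hD
      obtain rfl := hd.eq_of_zero a b (by omega)
      exact .nil _ (Nat.zero_le _)
    · simp only [Between] at hq hau
      have t1 := hd.triangle b a u
      have t2 := hd.triangle b u q
      have s2 := hd.symm z q
      have s3 := hd.symm z b
      have s4 := hd.symm q b
      have t3 := hd.triangle p a u
      have w1 : WalkIn d (fun v => D ≤ d p v) a u (8 * D) := by
        refine hd.walkIn a u hu.le fun v hv => ha v ?_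
        have t4 := hd.triangle a v z
        have t5 := hd.triangle v u z
        simp only [Between] at hv ⊢
        omega
      have w2 : WalkIn d (fun v => D ≤ d p v) u q D := by
        refine hd.walkIn u q hqu fun v hv => ?_
        simp only [Between] at hv
        have t4 := hd.triangle a p u
        have t5 := hd.triangle p v u
        have s5 := hd.symm v u
        have s6 := hd.symm a p
        omega
      have w3 : WalkIn d (fun v => D ≤ d p v) b q (15 * D) := by
        refine hd.walkIn b q (by omega) fun v hv => hb v ?_
        have t4 := hd.triangle b v z
        have t5 := hd.triangle v q z
        simp only [Between] at hv ⊢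
        omega
      exact ((w1.append w2).append (w3.symm hd)).mono (by omega)

/-- From a vertex `p` of a side `[x, y]`, going back by `2 D` towards `x` and then to a nearby point
of the other two sides stays outside the ball of radius `D` around `p`. -/
theorem ThinUpTo.exit_side (hd : IsDiscreteGeodesic d) {N D : ℕ} (hT : ThinUpTo d N D)
    {x y z p : V} (hxy : d x y ≤ N) (hyz : d y z ≤ N) (hxz : d x z ≤ N) (hp : Between d x y p)
    (hx : D ≤ d p x) :
    ∃ x' x'', Between d x p x' ∧ d x' p ≤ 2 * D ∧ (Between d x z x'' ∨ Between d y z x'') ∧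
      d x' x'' ≤ D ∧ WalkIn d (fun v => D ≤ d p v) x' x'' D := by
  have s1 := hd.symm x p
  simp only [Between] at hp
  by_cases h : d x p ≤ 2 * D
  · refine ⟨x, x, by simp [Between, hd.self], h, .inl (by simp [Between, hd.self]), ?_, .nil _ hx⟩
    simp [hd.self]
  · obtain ⟨x', h1, h2⟩ := hd.between x p (d x p - 2 * D) (by omega)
    have t1 := hd.triangle x x' y
    have t2 := hd.triangle x' p y
    obtain ⟨x'', h3, h4⟩ := hT x y z hxy hyz hxz x' (by simp only [Between]; omega)
    refine ⟨x', x'', by simp only [Between]; omega, by omega, h3, h4, hd.walkIn _ _ h4 ?_⟩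
    intro v hv
    simp only [Between] at hv
    have t3 := hd.triangle x' v p
    have s2 := hd.symm v p
    omega

/-- Thinness improves itself, down to a constant that does not depend on the size of triangles. -/
theorem LinearStokes.thinUpTo_pred (hd : IsDiscreteGeodesic d) {K : ℕ} (hK : LinearStokes d K)
    {N D : ℕ} (hD : 16 * K ≤ D) (hN : 6 * (D + 1) ≤ N) (hT : ThinUpTo d N (D + 1)) :
    ThinUpTo d N D := by
  intro x y z hxy hyz hxz p hp
  by_contra! hc
  have hxp : D + 1 ≤ d p x := hc x (.inl (by simp [Between, hd.self]))
  have hyp : D + 1 ≤ d p y := hc y (.inr (by simp [Between, hd.self]))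
  obtain ⟨x', x'', hx1, hx2, hx3, hx4, wx⟩ := hT.exit_side hd hxy hyz hxz hp hxp
  obtain ⟨y', y'', hy1, hy2, hy3, hy4, wy⟩ := hT.exit_side (p := p) hd
    (by rw [hd.symm]; exact hxy) hxz hyz
    (by simp only [Between] at hp ⊢; rw [hd.symm y p, hd.symm p x, hd.symm y x]; omega) hyp
  have t1 := hd.triangle x' p y'
  have t2 := hd.triangle x'' x' y''
  have t3 := hd.triangle x' y' y''
  have t4 := hd.triangle p x' x''
  have s1 := hd.symm x'' x'
  have s2 := hd.symm y' p
  have s3 := hd.symm x' p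
  -- Points of either side bound subsegments to `z` in that side.
  have sub : ∀ q, (Between d x z q ∨ Between d y z q) →
      d q z ≤ N ∧ ∀ v, Between d q z v → D + 1 ≤ d p v := by
    intro q hq
    rcases hq with hq | hq
    · refine ⟨by simp only [Between] at hq; omega, fun v hv => hc v (.inl ?_)⟩
      have := hd.triangle x q v
      have := hd.triangle x v z
      simp only [Between] at hq hv ⊢
      omega
    · refine ⟨by simp only [Between] at hq; omega, fun v hv => hc v (.inr ?_)⟩
      have := hd.triangle y q v
      have := hd.triangle y v z
      simp only [Between] at hq hv ⊢
      omega
  obtain ⟨hx5, hx6⟩ := sub x'' hx3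
  obtain ⟨hy5, hy6⟩ := sub y'' hy3.symm
  have w := hT.hinge hd hx5 hy5 hN (by omega) (by omega) hx6 hy6
  have hp' : Between d x' y' p := by
    have t5 := hd.triangle x x' y
    have t6 := hd.triangle x' y' y
    have s4 := hd.symm y y'
    have s5 := hd.symm y p
    simp only [Between] at hp hx1 hy1 ⊢
    omega
  have h1 := hK.separation hd hp' (((wx.append w).append (wy.symm hd)).symm hd)
  have h2 : K * (d x' y' + (D + 1 + 24 * (D + 1) + (D + 1)) + 1) ≤ K * (31 * (D + 1)) :=
    Nat.mul_le_mul_left _ (by omega)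
  nlinarith

/-- A linear bound on the integrals of `φ dh` around closed walks makes triangles uniformly thin. -/
theorem LinearStokes.thinUpTo (hd : IsDiscreteGeodesic d) {K : ℕ} (hK : LinearStokes d K) (N : ℕ) :
    ThinUpTo d N (16 * K) := by
  -- At scale `6 D` the separation estimate alone gives `D`-thinness.
  have start : ThinUpTo d (6 * (16 * K + 1 + N)) (16 * K + 1 + N) := by
    refine hK.thinUpTo_of_lt hd ?_
    nlinarith
  have down : ∀ j, j ≤ 1 + N → ThinUpTo d (6 * (16 * K + 1 + N)) (16 * K + (1 + N - j)) := by
    intro j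
    induction j with
    | zero => intro _; simpa [add_assoc] using start
    | succ j ih =>
      intro hj
      refine hK.thinUpTo_pred hd (by omega) (by omega) ?_
      rw [show 16 * K + (1 + N - (j + 1)) + 1 = 16 * K + (1 + N - j) by omega]
      exact ih (by omega)
  have := down (1 + N) le_rfl
  rw [Nat.sub_self, add_zero] at this
  intro x y z h1 h2 h3
  exact this x y z (by omega) (by omega) (by omega)

end Bootstrap

/-- Thin triangles imply the four-point condition: on a geodesic from `x` to `p` there is a vertex
close to both `[x, y]` and `[p, y]`, and it is also close to `[x, z]` or to `[p, z]`. -/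
theorem fourPoint_of_thin {V : Type*} {d : V → V → ℕ} (hd : IsDiscreteGeodesic d) {D : ℕ}
    (hT : ∀ N, ThinUpTo d N D) : FourPoint d (4 * D + 2) := by
  intro x y z p
  have thin : ∀ x y z p, Between d x y p → ∃ q, (Between d x z q ∨ Between d y z q) ∧ d p q ≤ D :=
    fun x y z => hT (d x y + d y z + d x z) x y z (by omega) (by omega) (by omega)
  -- Moving along a geodesic from `x` to `p`, one switches from the neighbourhood of `[x, y]` to
  -- that of `[p, y]`.
  have switch : ∀ k v, d v p = k → Between d x p v → (∃ q, Between d x y q ∧ d v q ≤ D) →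
      ∃ v, Between d x p v ∧ (∃ q, Between d x y q ∧ d v q ≤ D) ∧
        ∃ q, Between d p y q ∧ d v q ≤ D + 1 := by
    intro k
    induction k with
    | zero =>
      intro v hv hv1 hv2
      obtain rfl := hd.eq_of_zero _ _ hv
      exact ⟨v, hv1, hv2, v, by simp [Between, hd.self], by simp [hd.self]⟩
    | succ k ih =>
      intro v hv hv1 hv2
      obtain ⟨u, hu, hu'⟩ := hd.between v p 1 (by omega)
      have hu1 : Between d x p u := by
        have := hd.triangle x v u
        have := hd.triangle x u p
        simp only [Between] at hv1 ⊢
        omega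
      obtain ⟨q, hq | hq, hqu⟩ := thin x p y u hu1
      · exact ih u (by omega) hu1 ⟨q, hq, hqu⟩
      · exact ⟨v, hv1, hv2, q, hq, by have := hd.triangle v u q; omega⟩
  obtain ⟨v, hv, ⟨q, hq, hqv⟩, r, hr, hrv⟩ := switch _ x rfl (by simp [Between, hd.self])
    ⟨x, by simp [Between, hd.self], by simp [hd.self]⟩
  have s1 := hd.symm v q
  have s2 := hd.symm v r
  simp only [Between] at hv hq hr
  have s5 := hd.symm p y
  have s6 := hd.symm p z
  obtain ⟨t, ht | ht, htv⟩ := thin x p z v hv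
  all_goals
    have s3 := hd.symm v t
    simp only [Between] at ht
  · -- `v` is close to `[x, z]` and to `[p, y]`
    have t1 := hd.triangle x t v
    have t2 := hd.triangle v t z
    have t3 := hd.triangle p r v
    have t4 := hd.triangle v r y
    have t5 := hd.triangle y v z
    have t6 := hd.symm y v
    have t7 := hd.symm p v
    omega
  · -- `v` is close to `[x, y]` and to `[p, z]`
    have t1 := hd.triangle x q v
    have t2 := hd.triangle v q y
    have t3 := hd.triangle p t v
    have t4 := hd.triangle v t z
    have t5 := hd.triangle y v z
    have t6 := hd.symm y v
    have t7 := hd.symm p v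
    omega

/-! ### Word metric -/

/-- The word metric of `G` with respect to `X`, with values in `ℕ`. -/
noncomputable def wordDist {G : Type*} [Group G] (X : Set G) (u v : G) : ℕ :=
  (SimpleGraph.mulCayley X).dist u v

section WordDist

variable {G : Type*} [Group G] {X : Set G}

theorem isDiscreteGeodesic_wordDist (hX : Subgroup.closure X = ⊤) :
    IsDiscreteGeodesic (wordDist X) where
  self _ := SimpleGraph.dist_self
  eq_of_zero _ _ h := (CayleyPoint.connected hX).dist_eq_zero_iff.1 h
  symm _ _ := SimpleGraph.dist_comm
  triangle _ _ _ := (CayleyPoint.connected hX).dist_triangle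
  between x y k hk := by
    obtain ⟨w, hw⟩ := (CayleyPoint.connected hX).exists_walk_length_eq_dist x y
    have h1 := SimpleGraph.dist_le (w.take k)
    have h2 := SimpleGraph.dist_le (w.drop k)
    have h3 := (CayleyPoint.connected hX).dist_triangle (u := x) (v := w.getVert k) (w := y)
    rw [SimpleGraph.Walk.take_length] at h1
    rw [SimpleGraph.Walk.drop_length] at h2
    refine ⟨w.getVert k, ?_, ?_⟩ <;> simp only [wordDist] at * <;> omega

theorem wordDist_mul_le_one (g : G) (s : X) : wordDist X g (g * s) ≤ 1 :=
  CayleyPoint.dist_edge_le_one g s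

theorem eq_or_mul_eq_of_wordDist_le_one (hX : Subgroup.closure X = ⊤) {u v : G}
    (h : wordDist X u v ≤ 1) : u = v ∨ ∃ s : X, u * s = v ∨ v * s = u := by
  by_cases huv : u = v
  · exact .inl huv
  · have h0 : wordDist X u v ≠ 0 := fun h0 =>
      huv ((isDiscreteGeodesic_wordDist hX).eq_of_zero u v h0)
    have h1 : (SimpleGraph.mulCayley X).dist u v = 1 := by simp only [wordDist] at *; omega
    obtain ⟨-, s, hs, h2⟩ :=
      (SimpleGraph.mulCayley_adj' X u v).1 (SimpleGraph.dist_eq_one_iff_adj.1 h1)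
    exact .inr ⟨⟨s, hs⟩, h2.imp_right Eq.symm⟩

end WordDist

/-! ### Geodesic segments in the Cayley graph -/

namespace CayleyPoint

variable {G : Type*} [Group G] {X : Set G} {hX : Subgroup.closure X = ⊤}

theorem dist_le_of_route {p q : CayleyPoint X hX} {a : ℝ} (h : Route p q a) : dist p q ≤ a :=
  csInf_le (bddBelow_route p q) h

theorem dist_le_of_exit {p : CayleyPoint X hX} {u : G} {c : ℝ} (h : Exit p u c) :
    dist p (.vertex u) ≤ c := by
  have := dist_le_of_route (Route.through h (Exit.vertex (hX := hX) u))
  simpa using this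

theorem exists_vertex_dist_le_one (p : CayleyPoint X hX) : ∃ u, dist p (.vertex u) ≤ 1 := by
  cases p with
  | vertex g => exact ⟨g, by simp⟩
  | edge g s t => exact ⟨g, (dist_le_of_exit (.source g s t)).trans t.2.2⟩

/-- An edge as a path in the Cayley graph. -/
theorem exists_edge_path (u v : G) (huv : wordDist X u v ≤ 1) :
    ∃ e : ℝ → CayleyPoint X hX, e 0 = .vertex u ∧ ∀ t ∈ Set.Icc (0 : ℝ) 1,
      dist (e t) (.vertex u) ≤ t ∧ dist (e t) (.vertex v) ≤ 1 - t ∧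
      ∀ s ∈ Set.Icc (0 : ℝ) 1, dist (e s) (e t) ≤ |s - t| := by
  -- It is enough to parametrise the edge after its initial vertex.
  suffices ∃ e : ℝ → CayleyPoint X hX, ∀ t ∈ Set.Icc (0 : ℝ) 1,
      dist (e t) (.vertex u) ≤ t ∧ dist (e t) (.vertex v) ≤ 1 - t ∧
      ∀ s ∈ Set.Icc (0 : ℝ) 1, dist (e s) (e t) ≤ |s - t| by
    obtain ⟨e, he⟩ := this
    have h1 : dist (.vertex u : CayleyPoint X hX) (.vertex v) ≤ 1 := by
      rw [dist_vertex]; exact_mod_cast huv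
    refine ⟨fun t => if t = 0 then .vertex u else e t, by simp, fun t ht => ⟨?_, ?_, fun s hs => ?_⟩⟩
    · dsimp only
      split_ifs with h
      · simp [h]
      · exact (he t ht).1
    · dsimp only
      split_ifs with h
      · simpa [h] using h1
      · exact (he t ht).2.1
    · dsimp only
      split_ifs with h h' h'
      · simp
      · rw [dist_comm, h, zero_sub, abs_neg, abs_of_nonneg ht.1]; exact (he t ht).1
      · rw [h', sub_zero, abs_of_nonneg hs.1]; exact (he s hs).1
      · exact (he t ht).2.2 s hs
  rcases eq_or_mul_eq_of_wordDist_le_one hX huv with rfl | ⟨x, rfl | rfl⟩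
  · exact ⟨fun _ => .vertex u, fun t ht => by simpa using ht⟩
  · refine ⟨fun t => .edge u x (Set.projIcc 0 1 zero_le_one t), fun t ht => ?_⟩
    have ht' : ((Set.projIcc 0 1 zero_le_one t : unitInterval) : ℝ) = t := by
      rw [Set.projIcc_of_mem _ ht]
    refine ⟨?_, ?_, fun s hs => ?_⟩
    · simpa [ht'] using dist_le_of_exit (Exit.source (hX := hX) u x (Set.projIcc 0 1 zero_le_one t))
    · simpa [ht'] using dist_le_of_exit (Exit.target (hX := hX) u x (Set.projIcc 0 1 zero_le_one t))
    · have hs' : ((Set.projIcc 0 1 zero_le_one s : unitInterval) : ℝ) = s := by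
        rw [Set.projIcc_of_mem _ hs]
      have := dist_le_of_route (Route.inside (hX := hX) u x (Set.projIcc 0 1 zero_le_one s)
        (Set.projIcc 0 1 zero_le_one t))
      rwa [ht', hs'] at this
  · have hsymm : ∀ t ∈ Set.Icc (0 : ℝ) 1,
        ((Set.projIcc 0 1 zero_le_one (1 - t) : unitInterval) : ℝ) = 1 - t := by
      intro t ht
      rw [Set.projIcc_of_mem _ ⟨by linarith [ht.2], by linarith [ht.1]⟩]
    refine ⟨fun t => .edge v x (Set.projIcc 0 1 zero_le_one (1 - t)), fun t ht => ?_⟩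
    have ht' := hsymm t ht
    refine ⟨?_, ?_, fun s hs => ?_⟩
    · have := dist_le_of_exit (Exit.target (hX := hX) v x (Set.projIcc 0 1 zero_le_one (1 - t)))
      rwa [ht', sub_sub_cancel] at this
    · have := dist_le_of_exit (Exit.source (hX := hX) v x (Set.projIcc 0 1 zero_le_one (1 - t)))
      rwa [ht'] at this
    · have hs' := hsymm s hs
      have := dist_le_of_route (Route.inside (hX := hX) v x
        (Set.projIcc 0 1 zero_le_one (1 - s)) (Set.projIcc 0 1 zero_le_one (1 - t)))
      rwa [ht', hs', sub_sub_sub_cancel_left, abs_sub_comm] at this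

/-- A vertex between `x` and `y` lies on a geodesic segment of the Cayley graph, all of whose points
are close to vertices between `x` and `y`. -/
theorem exists_geodesicSegment {x y p : G} (hp : Between (wordDist X) x y p) :
    ∃ A : Set (CayleyPoint X hX), IsGeodesicSegment A (.vertex x) (.vertex y) ∧ .vertex p ∈ A ∧
      ∀ q ∈ A, ∃ v, Between (wordDist X) x y v ∧ dist q (.vertex v) ≤ 1 := by
  obtain ⟨w₁, hw₁⟩ := (connected hX).exists_walk_length_eq_dist x p
  obtain ⟨w₂, hw₂⟩ := (connected hX).exists_walk_length_eq_dist p y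
  obtain ⟨w, hw⟩ : ∃ w, w = w₁.append w₂ := ⟨_, rfl⟩
  have hlen : w.length = wordDist X x y := by
    rw [hw, SimpleGraph.Walk.length_append, hw₁, hw₂]; exact hp
  have hwp : w.getVert (wordDist X x p) = p := by
    rw [hw, SimpleGraph.Walk.getVert_append, hw₁]
    simp [wordDist]
  have hstep : ∀ i, wordDist X (w.getVert i) (w.getVert (i + 1)) ≤ 1 := by
    intro i
    by_cases hi : i < w.length
    · exact (SimpleGraph.dist_eq_one_iff_adj.2 (w.adj_getVert_succ hi)).le
    · rw [w.getVert_of_length_le (by omega), w.getVert_of_length_le (by omega)]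
      simp [wordDist]
  have hsteps : ∀ i k, wordDist X (w.getVert i) (w.getVert (i + k)) ≤ k := by
    intro i k
    induction k with
    | zero => simp [wordDist]
    | succ k ih =>
      have := (isDiscreteGeodesic_wordDist hX).triangle (w.getVert i) (w.getVert (i + k))
        (w.getVert (i + k + 1))
      have := hstep (i + k)
      rw [← add_assoc]
      omega
  set n := wordDist X x y with hn
  choose e he0 he using fun i => exists_edge_path (hX := hX) _ _ (hstep i)
  have hfr : ∀ t : ℝ, 0 ≤ t → t - ⌊t⌋₊ ∈ Set.Icc (0 : ℝ) 1 := fun t ht =>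
    ⟨by linarith [Nat.floor_le ht], by linarith [Nat.lt_floor_add_one t]⟩
  set γ : ℝ → CayleyPoint X hX := fun t => e ⌊t⌋₊ (t - ⌊t⌋₊) with hγ
  have hγn : ∀ i : ℕ, γ i = .vertex (w.getVert i) := by
    intro i
    simp [hγ, he0]
  have hlip : ∀ s t : ℝ, 0 ≤ s → s ≤ t → dist (γ s) (γ t) ≤ t - s := by
    intro s t hs hst
    have ht := hs.trans hst
    rcases (Nat.floor_mono hst).eq_or_lt with h | h
    · have h1 := (he ⌊t⌋₊ _ (hfr t ht)).2.2 (s - ⌊t⌋₊) (h ▸ hfr s hs)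
      simp only [hγ]
      rw [h]
      refine h1.trans (le_of_eq ?_)
      rw [sub_sub_sub_cancel_right, abs_sub_comm, abs_of_nonneg (by linarith)]
    · have h1 := (he ⌊s⌋₊ _ (hfr s hs)).2.1
      have h2 := (he ⌊t⌋₊ _ (hfr t ht)).1
      have h3 := hsteps (⌊s⌋₊ + 1) (⌊t⌋₊ - (⌊s⌋₊ + 1))
      rw [Nat.add_sub_cancel' h] at h3
      have h4 : dist (.vertex (w.getVert (⌊s⌋₊ + 1)) : CayleyPoint X hX)
          (.vertex (w.getVert ⌊t⌋₊)) ≤ ⌊t⌋₊ - (⌊s⌋₊ + 1) := by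
        rw [dist_vertex]
        have : ((⌊t⌋₊ - (⌊s⌋₊ + 1) : ℕ) : ℝ) = ⌊t⌋₊ - (⌊s⌋₊ + 1) := by
          rw [Nat.cast_sub h]; push_cast; ring
        rw [← this]
        exact_mod_cast h3
      have h5 := dist_triangle4 (γ s) (.vertex (w.getVert (⌊s⌋₊ + 1)))
        (.vertex (w.getVert ⌊t⌋₊)) (γ t)
      rw [dist_comm (.vertex (w.getVert ⌊t⌋₊)) (γ t)] at h5
      simp only [hγ] at h5 ⊢
      linarith
  have h0 : γ 0 = .vertex x := by
    have := hγn 0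
    rwa [Nat.cast_zero, w.getVert_zero] at this
  have h1 : γ n = .vertex y := by rw [hγn, ← hlen, w.getVert_length]
  have hiso : ∀ s t : ℝ, 0 ≤ s → s ≤ t → t ≤ n → dist (γ s) (γ t) = t - s := by
    intro s t hs hst ht
    refine le_antisymm (hlip s t hs hst) ?_
    have e1 := hlip 0 s le_rfl hs
    have e2 := hlip t n (hs.trans hst) ht
    have e3 := dist_triangle4 (γ 0) (γ s) (γ t) (γ n)
    have e4 : dist (γ 0) (γ n) = n := by rw [h0, h1, dist_vertex]; rfl
    linarith
  refine ⟨γ '' Set.Icc 0 n, ⟨n, γ, Nat.cast_nonneg n, h0, h1, ?_, rfl⟩, ?_, ?_⟩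
  · intro s hs t ht
    rcases le_total s t with h | h
    · rw [hiso s t hs.1 h ht.2, abs_sub_comm, abs_of_nonneg (by linarith)]
    · rw [dist_comm, hiso t s ht.1 h hs.2, abs_of_nonneg (by linarith)]
  · refine ⟨(wordDist X x p : ℝ), ⟨Nat.cast_nonneg _, ?_⟩, by rw [hγn, hwp]⟩
    have : wordDist X x p ≤ n := by simp only [Between] at hp; omega
    exact_mod_cast this
  · rintro q ⟨t, ht, rfl⟩
    refine ⟨w.getVert ⌊t⌋₊, ?_, ((he _ _ (hfr t ht.1)).1).trans (hfr t ht.1).2⟩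
    have hle : ⌊t⌋₊ ≤ n := Nat.floor_le_of_le ht.2
    have e1 := hsteps 0 ⌊t⌋₊
    have e2 := hsteps ⌊t⌋₊ (n - ⌊t⌋₊)
    have e3 := (isDiscreteGeodesic_wordDist hX).triangle x (w.getVert ⌊t⌋₊) y
    rw [w.getVert_zero, zero_add] at e1
    rw [Nat.add_sub_cancel' hle, ← hlen, w.getVert_length] at e2
    simp only [Between]
    omega

end CayleyPoint

/-! ### Thin triangles and the four-point condition -/

/-- If the geodesic triangles of the Cayley graph are thin, then so are those formed by the
intervals of the word metric. -/
theorem IsDeltaHyperbolic.thinUpTo {G : Type*} [Group G] {X : Set G} {hX : Subgroup.closure X = ⊤}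
    {δ : ℝ} (h : IsDeltaHyperbolic (CayleyPoint X hX) δ) (N : ℕ) :
    ThinUpTo (wordDist X) N ⌈δ + 1⌉₊ := by
  intro x y z _ _ _ p hp
  have hself : ∀ u v : G, Between (wordDist X) u v u := fun u v => by simp [Between, wordDist]
  obtain ⟨A, hA, hpA, -⟩ := CayleyPoint.exists_geodesicSegment (hX := hX) hp
  obtain ⟨B, hB, -, hB'⟩ := CayleyPoint.exists_geodesicSegment (hX := hX) (hself y z)
  obtain ⟨C, hC, -, hC'⟩ := CayleyPoint.exists_geodesicSegment (hX := hX) (hself z x)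
  obtain ⟨q, hq, hpq⟩ := h _ _ _ A B C hA hB hC _ hpA
  have close : ∀ v, dist q (.vertex v : CayleyPoint X hX) ≤ 1 → wordDist X p v ≤ ⌈δ + 1⌉₊ := by
    intro v hv
    have h1 := dist_triangle (.vertex p : CayleyPoint X hX) q (.vertex v)
    rw [CayleyPoint.dist_vertex] at h1
    have h2 := Nat.le_ceil (δ + 1)
    have h3 : (wordDist X p v : ℝ) ≤ ⌈δ + 1⌉₊ := by simp only [wordDist]; linarith
    exact_mod_cast h3
  rcases hq with hq | hq
  · obtain ⟨v, hv, hqv⟩ := hB' q hq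
    exact ⟨v, .inr hv, close v hqv⟩
  · obtain ⟨v, hv, hqv⟩ := hC' q hq
    refine ⟨v, .inl ?_, close v hqv⟩
    have hd := isDiscreteGeodesic_wordDist hX
    simp only [Between] at hv ⊢
    rw [hd.symm x v, hd.symm v z, hd.symm x z]
    omega

section FourPointSpace

variable {S : Type*} [PseudoMetricSpace S] {δ : ℝ}

/-- A point whose distances to the ends of a geodesic segment nearly add up to its length is close
to the segment. -/
theorem exists_mem_segment_dist_le (hδ : 0 ≤ δ)
    (h4 : ∀ x y z p : S, dist x p + dist y z ≤ max (dist x y + dist z p) (dist x z + dist y p) + δ)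
    {A : Set S} {a b p : S} (hA : IsGeodesicSegment A a b)
    (hp : dist a p + dist p b ≤ dist a b + δ) : ∃ q ∈ A, dist p q ≤ 2 * δ := by
  obtain ⟨ℓ, γ, hℓ, rfl, rfl, hγ, rfl⟩ := hA
  have h0 : (0 : ℝ) ∈ Set.Icc 0 ℓ := ⟨le_rfl, hℓ⟩
  have h1 : ℓ ∈ Set.Icc 0 ℓ := ⟨hℓ, le_rfl⟩
  set t := min (dist (γ 0) p) ℓ with ht
  have htm : t ∈ Set.Icc 0 ℓ := ⟨le_min dist_nonneg hℓ, min_le_right _ _⟩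
  refine ⟨γ t, ⟨t, htm, rfl⟩, ?_⟩
  have e1 := hγ 0 h0 t htm
  have e2 := hγ t htm ℓ h1
  have e3 := hγ 0 h0 ℓ h1
  rw [zero_sub, abs_neg, abs_of_nonneg htm.1] at e1
  rw [abs_sub_comm, abs_of_nonneg (by linarith [htm.2])] at e2
  rw [zero_sub, abs_neg, abs_of_nonneg hℓ] at e3
  have key := h4 p (γ 0) (γ ℓ) (γ t)
  rw [dist_comm p (γ 0), dist_comm (γ ℓ) (γ t), e1, e2, e3] at key
  rw [e3] at hp
  have hpb : 0 ≤ dist p (γ ℓ) := dist_nonneg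
  have m1 : dist (γ 0) p + (ℓ - t) ≤ ℓ + δ := by
    rcases min_choice (dist (γ 0) p) ℓ with h | h <;> rw [ht, h] <;> linarith
  have m2 : dist p (γ ℓ) + t ≤ ℓ + δ := by linarith [min_le_left (dist (γ 0) p) ℓ]
  have := max_le m1 m2
  linarith

theorem isDeltaHyperbolic_of_fourPoint (hδ : 0 ≤ δ)
    (h4 : ∀ x y z p : S,
      dist x p + dist y z ≤ max (dist x y + dist z p) (dist x z + dist y p) + δ) :
    IsDeltaHyperbolic S (2 * δ) := by
  intro x y z A B C hA hB hC p hp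
  have hxy : dist x p + dist p y = dist x y := by
    obtain ⟨ℓ, γ, hℓ, rfl, rfl, hγ, rfl⟩ := hA
    obtain ⟨t, ht, rfl⟩ := hp
    rw [hγ 0 ⟨le_rfl, hℓ⟩ t ht, hγ t ht ℓ ⟨hℓ, le_rfl⟩, hγ 0 ⟨le_rfl, hℓ⟩ ℓ ⟨hℓ, le_rfl⟩,
      zero_sub, abs_neg, abs_of_nonneg ht.1, abs_sub_comm, abs_of_nonneg (by linarith [ht.2]),
      zero_sub, abs_neg, abs_of_nonneg hℓ]
    ring
  have key := h4 z x y p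
  have c1 := dist_comm x p
  have c2 := dist_comm p y
  have c3 := dist_comm z p
  have c4 := dist_comm z y
  rcases le_total (dist z x + dist y p) (dist z y + dist x p) with h | h
  · rw [max_eq_right h] at key
    obtain ⟨q, hq, hpq⟩ := exists_mem_segment_dist_le hδ h4 hB (p := p) (by linarith)
    exact ⟨q, .inl hq, hpq⟩
  · rw [max_eq_left h] at key
    obtain ⟨q, hq, hpq⟩ := exists_mem_segment_dist_le hδ h4 hC (p := p) (by linarith)
    exact ⟨q, .inr hq, hpq⟩

end FourPointSpace

/-- The four-point condition for the vertices of the Cayley graph makes the group hyperbolic. -/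
theorem FourPoint.isHyperbolicGroup {G : Type*} [Group G] {X : Set G} (hfin : X.Finite)
    (hX : Subgroup.closure X = ⊤) {δ : ℕ} (h : FourPoint (wordDist X) δ) : IsHyperbolicGroup G := by
  refine ⟨X, hX, hfin, 2 * (δ + 8), by positivity,
    isDeltaHyperbolic_of_fourPoint (by positivity) fun x y z p => ?_⟩
  obtain ⟨x', hx⟩ := CayleyPoint.exists_vertex_dist_le_one x
  obtain ⟨y', hy⟩ := CayleyPoint.exists_vertex_dist_le_one y
  obtain ⟨z', hz⟩ := CayleyPoint.exists_vertex_dist_le_one z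
  obtain ⟨p', hp⟩ := CayleyPoint.exists_vertex_dist_le_one p
  have approx : ∀ {u v : CayleyPoint X hX} {u' v' : G}, dist u (.vertex u') ≤ 1 →
      dist v (.vertex v') ≤ 1 →
      dist u v ≤ wordDist X u' v' + 2 ∧ (wordDist X u' v' : ℝ) ≤ dist u v + 2 := by
    intro u v u' v' hu hv
    have t1 := dist_triangle4 u (.vertex u') (.vertex v') v
    have t2 := dist_triangle4 (.vertex u' : CayleyPoint X hX) u v (.vertex v')
    rw [CayleyPoint.dist_vertex, dist_comm (.vertex v') v] at t1
    rw [CayleyPoint.dist_vertex, dist_comm (.vertex u') u] at t2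
    simp only [wordDist]
    constructor <;> linarith
  have key : (wordDist X x' p' : ℝ) + wordDist X y' z' ≤
      max ((wordDist X x' y' : ℝ) + wordDist X z' p') (wordDist X x' z' + wordDist X y' p') + δ := by
    exact_mod_cast h x' y' z' p'
  have m : max ((wordDist X x' y' : ℝ) + wordDist X z' p') (wordDist X x' z' + wordDist X y' p') ≤
      max (dist x y + dist z p) (dist x z + dist y p) + 4 := by
    refine max_le ?_ ?_
    · linarith [le_max_left (dist x y + dist z p) (dist x z + dist y p), (approx hx hy).2,
        (approx hz hp).2]
    · linarith [le_max_right (dist x y + dist z p) (dist x z + dist y p), (approx hx hz).2,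
        (approx hy hp).2]
  linarith [(approx hx hp).1, (approx hy hz).1]

/-! ### Words and products of conjugates -/

/-- `g` is given by a word, not necessarily reduced, of length at most `n`. -/
def HasLength {α : Type*} (g : FreeGroup α) (n : ℕ) : Prop :=
  ∃ L : List (α × Bool), L.length ≤ n ∧ FreeGroup.mk L = g

namespace HasLength

variable {α β : Type*} {g h : FreeGroup α} {n m : ℕ}

theorem one (n : ℕ) : HasLength (1 : FreeGroup α) n := ⟨[], Nat.zero_le n, rfl⟩

theorem mono (hg : HasLength g n) (hnm : n ≤ m) : HasLength g m := by
  obtain ⟨L, hL, rfl⟩ := hg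
  exact ⟨L, hL.trans hnm, rfl⟩

theorem mul (hg : HasLength g n) (hh : HasLength h m) : HasLength (g * h) (n + m) := by
  obtain ⟨L, hL, rfl⟩ := hg
  obtain ⟨M, hM, rfl⟩ := hh
  exact ⟨L ++ M, by rw [List.length_append]; omega, rfl⟩

theorem inv (hg : HasLength g n) : HasLength g⁻¹ n := by
  obtain ⟨L, hL, rfl⟩ := hg
  exact ⟨FreeGroup.invRev L, by rwa [FreeGroup.invRev_length], rfl⟩

theorem split (hg : HasLength g n) (k : ℕ) :
    ∃ u v, g = u * v ∧ HasLength u k ∧ HasLength v (n - k) := by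
  obtain ⟨L, hL, rfl⟩ := hg
  refine ⟨.mk (L.take k), .mk (L.drop k), ?_, ⟨_, by simp, rfl⟩, ⟨_, ?_, rfl⟩⟩
  · rw [FreeGroup.mul_mk, List.take_append_drop]
  · rw [List.length_drop]; omega

theorem exists_hasLength (g : FreeGroup α) : ∃ n, HasLength g n := by
  classical exact ⟨_, g.toWord, le_rfl, FreeGroup.mk_toWord⟩

theorem of (a : α) : HasLength (FreeGroup.of a) 1 := ⟨[(a, true)], le_rfl, rfl⟩

/-- Induction on words: a word is obtained by prepending letters to the empty word. -/
theorem induction {P : FreeGroup α → ℕ → Prop} (one : ∀ n, P 1 n)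
    (of_mul : ∀ a g n, P g n → P (FreeGroup.of a * g) (n + 1))
    (inv_mul : ∀ a g n, P g n → P ((FreeGroup.of a)⁻¹ * g) (n + 1))
    (hg : HasLength g n) : P g n := by
  obtain ⟨L, hL, rfl⟩ := hg
  induction L generalizing n with
  | nil => exact one n
  | cons x L ih =>
    obtain ⟨n, rfl⟩ : ∃ k, n = k + 1 := ⟨n - 1, by rw [List.length_cons] at hL; omega⟩
    have h := ih (n := n) (by rw [List.length_cons] at hL; omega)
    obtain ⟨a, _ | _⟩ := x
    · exact inv_mul a _ _ h
    · exact of_mul a _ _ h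

theorem map {c : ℕ} {φ : FreeGroup α →* FreeGroup β} (hφ : ∀ a, HasLength (φ (FreeGroup.of a)) c)
    (hg : HasLength g n) : HasLength (φ g) (c * n) := by
  refine induction (P := fun g n => HasLength (φ g) (c * n)) (fun n => ?_) (fun a g n h => ?_)
    (fun a g n h => ?_) hg
  · rw [map_one]; exact one _
  · rw [map_mul, mul_add_one, add_comm]; exact (hφ a).mul h
  · rw [map_mul, map_inv, mul_add_one, add_comm]; exact (hφ a).inv.mul h

end HasLength

theorem mem_shortRelators {G : Type*} [Group G] {X : Set G} {k : ℕ} {r : FreeGroup X} :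
    r ∈ shortRelators X k ↔ HasLength r k ∧ wordEval X r = 1 := by
  constructor
  · rintro ⟨L, h1, h2, h3⟩
    exact ⟨⟨L, h1, h2⟩, h3⟩
  · rintro ⟨⟨L, h1, h2⟩, h3⟩
    exact ⟨L, h1, h2, h3⟩

namespace IsProdOfConj

variable {F F' : Type*} [Group F] [Group F'] {𝓡 : Set F} {𝓡' : Set F'} {l l' : ℕ} {g h : F}

theorem of_mem (hg : g ∈ 𝓡) : IsProdOfConj 𝓡 1 g :=
  ⟨[g], rfl, by simp, fun p hp => ⟨1, g, hg, .inl (by simpa using hp)⟩⟩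

theorem mul (hg : IsProdOfConj 𝓡 l g) (hh : IsProdOfConj 𝓡 l' h) :
    IsProdOfConj 𝓡 (l + l') (g * h) := by
  obtain ⟨P, rfl, rfl, hP⟩ := hg
  obtain ⟨Q, rfl, rfl, hQ⟩ := hh
  refine ⟨P ++ Q, List.length_append, List.prod_append, fun p hp => ?_⟩
  rcases List.mem_append.1 hp with hp | hp
  exacts [hP p hp, hQ p hp]

theorem map (φ : F →* F') (hφ : ∀ r ∈ 𝓡, φ r ∈ 𝓡') (hg : IsProdOfConj 𝓡 l g) :
    IsProdOfConj 𝓡' l (φ g) := by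
  obtain ⟨P, rfl, rfl, hP⟩ := hg
  refine ⟨P.map φ, List.length_map _, (map_list_prod φ P).symm, fun p hp => ?_⟩
  obtain ⟨p, hp', rfl⟩ := List.mem_map.1 hp
  obtain ⟨f, R, hR, rfl | rfl⟩ := hP p hp'
  · exact ⟨φ f, φ R, hφ R hR, .inl (by simp)⟩
  · exact ⟨φ f, φ R, hφ R hR, .inr (by simp)⟩

theorem conj (hg : IsProdOfConj 𝓡 l g) (f : F) : IsProdOfConj 𝓡 l (f * g * f⁻¹) := by
  obtain ⟨P, rfl, rfl, hP⟩ := hg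
  refine ⟨P.map (MulAut.conj f), List.length_map _, ?_, fun p hp => ?_⟩
  · rw [← MulAut.conj_apply, map_list_prod]
  obtain ⟨p, hp', rfl⟩ := List.mem_map.1 hp
  obtain ⟨e, R, hR, rfl | rfl⟩ := hP p hp'
  · exact ⟨e * f⁻¹, R, hR, .inl (by simp [mul_assoc])⟩
  · exact ⟨e * f⁻¹, R, hR, .inr (by simp [mul_assoc])⟩

theorem mono {𝓢 : Set F} (h𝓢 : 𝓡 ⊆ 𝓢) (hg : IsProdOfConj 𝓡 l g) : IsProdOfConj 𝓢 l g :=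
  hg.map (MonoidHom.id F) fun _ hr => h𝓢 hr

end IsProdOfConj

section Cayley

variable {G : Type*} [Group G] {X : Set G}

theorem HasLength.wordDist_le (hX : Subgroup.closure X = ⊤) {u : FreeGroup X} {n : ℕ}
    (hu : HasLength u n) (g : G) : wordDist X g (g * wordEval X u) ≤ n := by
  have hd := isDiscreteGeodesic_wordDist hX
  refine HasLength.induction (P := fun u n => ∀ g, wordDist X g (g * wordEval X u) ≤ n)
    (fun n g => ?_) (fun a u n ih g => ?_) (fun a u n ih g => ?_) hu g
  · simp [hd.self]
  · have h1 := ih (g * a)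
    have h2 := wordDist_mul_le_one g a
    have h3 := hd.triangle g (g * a) (g * a * wordEval X u)
    rw [map_mul, ← mul_assoc]
    simp only [wordEval, FreeGroup.lift_apply_of] at *
    omega
  · have h1 := ih (g * (a : G)⁻¹)
    have h2 := wordDist_mul_le_one (g * (a : G)⁻¹) a
    have h3 := hd.triangle g (g * (a : G)⁻¹) (g * (a : G)⁻¹ * wordEval X u)
    rw [inv_mul_cancel_right, hd.symm] at h2
    rw [map_mul, map_inv, ← mul_assoc]
    simp only [wordEval, FreeGroup.lift_apply_of] at *
    omega

theorem exists_hasLength_wordDist (hX : Subgroup.closure X = ⊤) (g h : G) :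
    ∃ u : FreeGroup X, HasLength u (wordDist X g h) ∧ g * wordEval X u = h := by
  have hd := isDiscreteGeodesic_wordDist hX
  generalize hn : wordDist X g h = n
  induction n generalizing g with
  | zero =>
    obtain rfl := hd.eq_of_zero g h hn
    exact ⟨1, .one _, by simp⟩
  | succ n ih =>
    obtain ⟨v, hv, hv'⟩ := hd.between g h 1 (by omega)
    obtain ⟨u, hu, rfl⟩ := ih v (by omega)
    rw [add_comm]
    rcases eq_or_mul_eq_of_wordDist_le_one hX hv.le with rfl | ⟨s, rfl | rfl⟩
    · exact ⟨u, hu.mono (by omega), rfl⟩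
    · exact ⟨.of s * u, (HasLength.of s).mul hu, by simp [wordEval, mul_assoc]⟩
    · exact ⟨(.of s)⁻¹ * u, (HasLength.of s).inv.mul hu, by simp [wordEval]⟩

theorem wordEval_surjective (hX : Subgroup.closure X = ⊤) : Function.Surjective (wordEval X) := by
  intro g
  obtain ⟨u, -, hu⟩ := exists_hasLength_wordDist hX 1 g
  exact ⟨u, by simpa using hu⟩

end Cayley

/-! ### Hyperbolic groups fill loops efficiently at every scale -/

/-- A long closed path in a hyperbolic space has a subpath of length `2 L` whose end points are at
distance at most `L + δ`: take the subpath around a vertex farthest from the base point. -/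
theorem FourPoint.exists_shortcut {V : Type*} {d : V → V → ℕ} (hd : IsDiscreteGeodesic d) {δ : ℕ}
    (h4 : FourPoint d δ) {L N : ℕ} (hN : 4 * L ≤ N) (v : ℕ → V) (hclosed : v N = v 0)
    (hv : ∀ i j, i ≤ j → j ≤ N → d (v i) (v j) ≤ j - i) :
    ∃ j, j + 2 * L ≤ N ∧ d (v j) (v (j + 2 * L)) ≤ L + δ := by
  obtain ⟨i, hi, hmax⟩ := Finset.exists_max_image (Finset.range (N + 1)) (fun i => d (v i) (v 0))
    ⟨0, by simp⟩
  simp only [Finset.mem_range] at hi hmax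
  by_cases hL : d (v i) (v 0) ≤ L
  · refine ⟨0, by omega, ?_⟩
    have := hmax (0 + 2 * L) (by omega)
    have := hd.symm (v 0) (v (0 + 2 * L))
    omega
  · have h1 := hv 0 i (by omega) (by omega)
    have h2 := hv i N (by omega) le_rfl
    rw [hclosed] at h2
    rw [hd.symm] at h1
    have h3 := h4 (v i) (v (i - L)) (v (i + L)) (v 0)
    have h5 := hv (i - L) i (by omega) (by omega)
    have h6 := hv i (i + L) (by omega) (by omega)
    have h7 := hmax (i - L) (by omega)
    have h8 := hmax (i + L) (by omega)
    have h9 := hd.symm (v (i - L)) (v i)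
    refine ⟨i - L, by omega, ?_⟩
    rw [show i - L + 2 * L = i + L by omega]
    omega

/-- In a hyperbolic group, words of length `n` representing `1` have area `O(n / L + 1)` with respect
to relators of length `O(L)`, uniformly in the scale `L`. -/
theorem FourPoint.exists_isProdOfConj {G : Type*} [Group G] {X : Set G}
    (hX : Subgroup.closure X = ⊤) {δ : ℕ} (h4 : FourPoint (wordDist X) δ) {L : ℕ} (hL : 1 ≤ L)
    (hδ : 2 * δ ≤ L) {n : ℕ} {w : FreeGroup X} (hw : HasLength w n) (hw1 : wordEval X w = 1) :
    ∃ l, l * L ≤ 2 * n + L ∧ IsProdOfConj (shortRelators X (4 * L)) l w := by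
  induction n using Nat.strong_induction_on generalizing w with
  | _ n ih =>
    obtain ⟨W, hW, rfl⟩ := hw
    by_cases hs : W.length ≤ 4 * L
    · exact ⟨1, by omega, .of_mem (mem_shortRelators.2 ⟨⟨W, hs, rfl⟩, hw1⟩)⟩
    have hd := isDiscreteGeodesic_wordDist hX
    have hstep : ∀ i j, wordEval X (.mk (W.take (i + j))) =
        wordEval X (.mk (W.take i)) * wordEval X (.mk ((W.drop i).take j)) := by
      intro i j
      rw [← map_mul, FreeGroup.mul_mk, ← List.take_add]
    have hlen : ∀ i j, HasLength (.mk ((W.drop i).take j) : FreeGroup X) j := fun i j =>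
      ⟨_, by simp, rfl⟩
    obtain ⟨j, hj, hdist⟩ := h4.exists_shortcut hd (L := L) (N := W.length) (by omega)
      (fun i => wordEval X (.mk (W.take i))) (by simpa [← FreeGroup.one_eq_mk] using hw1)
      (fun i k hik hk => by
        obtain ⟨k, rfl⟩ := Nat.exists_eq_add_of_le hik
        rw [hstep, Nat.add_sub_cancel_left]
        exact (hlen i k).wordDist_le hX _)
    obtain ⟨U, hU, hU'⟩ := exists_hasLength_wordDist hX (wordEval X (.mk (W.take j)))
      (wordEval X (.mk (W.take (j + 2 * L))))
    rw [hstep, mul_right_inj] at hU'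
    set A : FreeGroup X := .mk (W.take j) with hA
    set M : FreeGroup X := .mk ((W.drop j).take (2 * L)) with hM
    set C : FreeGroup X := .mk ((W.drop j).drop (2 * L)) with hC
    have hAl : HasLength A j := ⟨_, by simp, rfl⟩
    have hCl : HasLength C (W.length - j - 2 * L) := ⟨_, by simp [Nat.sub_sub], rfl⟩
    have hW' : (.mk W : FreeGroup X) = A * M * C := by
      rw [hA, hM, hC, mul_assoc, FreeGroup.mul_mk, List.take_append_drop, FreeGroup.mul_mk,
        List.take_append_drop]
    obtain ⟨l, hl, hprod⟩ := ih (W.length - L + δ) (by omega) (w := A * U * C)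
      (((hAl.mul (hU.mono hdist)).mul hCl).mono (by omega))
      (by rw [hW'] at hw1; simpa [hU'] using hw1)
    have hrel : M * U⁻¹ ∈ shortRelators X (4 * L) := mem_shortRelators.2
      ⟨((hlen j (2 * L)).mul (hU.mono hdist).inv).mono (by omega), by simp [hU', hM]⟩
    refine ⟨1 + l, by rw [add_mul]; omega, ?_⟩
    convert ((IsProdOfConj.of_mem hrel).conj A).mul hprod using 1
    rw [hW']
    group

/-- Translating a word over `X` into another alphabet and back changes it by few relators, since one
relator is enough for each subword of length `m`. -/
theorem exists_isProdOfConj_mul_map {G : Type*} [Group G] {X : Set G} {c : ℕ}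
    (θ : FreeGroup X →* FreeGroup X) (hθ : ∀ x, HasLength (θ (.of x)) c)
    (hθ' : ∀ w, wordEval X (θ w) = wordEval X w) {m : ℕ} (hm : 1 ≤ m) {n : ℕ} {w : FreeGroup X}
    (hw : HasLength w n) :
    ∃ l P, l * m ≤ n + m ∧ IsProdOfConj (shortRelators X ((c + 1) * m)) l P ∧ w = P * θ w := by
  induction n using Nat.strong_induction_on generalizing w with
  | _ n ih =>
    obtain ⟨u, v, rfl, hu, hv⟩ := hw.split m
    have hrel : u * (θ u)⁻¹ ∈ shortRelators X ((c + 1) * m) := mem_shortRelators.2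
      ⟨(hu.mul (hu.map hθ).inv).mono (by rw [add_mul]; omega), by simp [hθ']⟩
    by_cases hnm : n ≤ m
    · obtain ⟨L, hL, rfl⟩ := hv
      obtain rfl := List.eq_nil_of_length_eq_zero (l := L) (by omega)
      refine ⟨1, _, by omega, .of_mem hrel, ?_⟩
      simp [← FreeGroup.one_eq_mk]
    · obtain ⟨l, P, hl, hP, hv'⟩ := ih (n - m) (by omega) hv
      refine ⟨1 + l, _, by rw [add_mul]; omega,
        (IsProdOfConj.of_mem hrel).mul (hP.conj (θ u)), ?_⟩
      conv_lhs => rw [hv']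
      rw [map_mul]
      group

/-- A homomorphism of free groups that covers the identity of `G`, with its stretching factor. -/
theorem exists_translation {G : Type*} [Group G] {X Y : Set G} (hX : X.Finite)
    (hY : Subgroup.closure Y = ⊤) :
    ∃ (φ : FreeGroup X →* FreeGroup Y) (c : ℕ), (∀ x, HasLength (φ (.of x)) c) ∧
      ∀ w, wordEval Y (φ w) = wordEval X w := by
  have : Finite X := hX
  choose f hf using fun x : X => wordEval_surjective hY (x : G)
  choose len hlen using fun x : X => HasLength.exists_hasLength (f x)
  obtain ⟨c, hc⟩ := (Set.finite_range len).bddAbove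
  refine ⟨FreeGroup.lift f, c, fun x => ?_, fun w => ?_⟩
  · rw [FreeGroup.lift_apply_of]
    exact (hlen x).mono (hc ⟨x, rfl⟩)
  · have : (wordEval Y).comp (FreeGroup.lift f) = wordEval X := by
      ext x
      simpa [wordEval] using hf x
    exact DFunLike.congr_fun this w

/-- The fillings of `FourPoint.exists_isProdOfConj`, for an arbitrary finite generating set. -/
theorem IsHyperbolicGroup.exists_isProdOfConj {G : Type*} [Group G] (hG : IsHyperbolicGroup G)
    {X : Set G} (hX : X.Finite) (hgen : Subgroup.closure X = ⊤) :
    ∃ C, 1 ≤ C ∧ ∀ m n w, C ≤ m → HasLength w n → wordEval X w = 1 →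
      ∃ l, l * m ≤ C * (n + m) ∧ IsProdOfConj (shortRelators X (C * m)) l w := by
  obtain ⟨Y, hY, hYfin, δ, -, hδ⟩ := hG
  obtain ⟨δ', h4⟩ : ∃ δ', FourPoint (wordDist Y) δ' :=
    ⟨_, fourPoint_of_thin (isDiscreteGeodesic_wordDist hY) hδ.thinUpTo⟩
  obtain ⟨ψ, c, hψ, hψ'⟩ := exists_translation hX hY
  obtain ⟨φ, c', hφ, hφ'⟩ := exists_translation hYfin hgen
  refine ⟨2 * δ' + 2 * c + 4 * c' + c' * c + 2, by omega, fun m n w hm hw hw1 => ?_⟩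
  have hC₁ : 4 * c' + (c' * c + 1) ≤ 2 * δ' + 2 * c + 4 * c' + c' * c + 2 := by omega
  have hC₂ : 2 * c + 2 ≤ 2 * δ' + 2 * c + 4 * c' + c' * c + 2 := by omega
  have hC₃ : 2 * δ' + 1 ≤ 2 * δ' + 2 * c + 4 * c' + c' * c + 2 := by omega
  generalize 2 * δ' + 2 * c + 4 * c' + c' * c + 2 = C at *
  obtain ⟨l, P, hl, hP, hwP⟩ := exists_isProdOfConj_mul_map (φ.comp ψ)
    (fun x => HasLength.map (φ := φ) hφ (hψ x)) (fun w => by simp [hφ', hψ']) (m := m) (by omega) hw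
  obtain ⟨l', hl', hprod⟩ := h4.exists_isProdOfConj hY (L := m) (by omega) (by omega)
    (hw.map hψ) (by rw [hψ', hw1])
  refine ⟨l + l', ?_, ?_⟩
  · have h1 := Nat.mul_le_mul_right (n + m) hC₂
    nlinarith
  · rw [hwP]
    refine (hP.mono (shortRelators_mono X (Nat.mul_le_mul_right m (by omega)))).mul
      (hprod.map φ fun r hr => ?_)
    obtain ⟨hr, hr1⟩ := mem_shortRelators.1 hr
    refine mem_shortRelators.2 ⟨(hr.map hφ).mono ?_, by rw [hφ', hr1]⟩
    have := Nat.mul_le_mul_right m (show 4 * c' ≤ C by omega)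
    nlinarith

/-! ### Integration along words -/

/-- The trapezoidal approximation of `2 φ dh` on the edge from `u` to `v`. -/
def edgeForm {G : Type*} (φ h : G → ℤ) (u v : G) : ℤ := (φ u + φ v) * (h v - h u)

/-- `I w g` integrates the form `2 φ dh` along the path in the Cayley graph that starts at `g` and
reads the word `w`. -/
structure IsWordIntegral {G : Type*} [Group G] {X : Set G} (φ h : G → ℤ)
    (I : FreeGroup X → G → ℤ) : Prop where
  mul : ∀ w w' g, I (w * w') g = I w g + I w' (g * wordEval X w)
  of : ∀ x g, I (FreeGroup.of x) g = edgeForm φ h g (g * x)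

/-- As the form changes its sign with the orientation of edges, its integral along a word depends on
the element of the free group only. -/
theorem exists_isWordIntegral {G : Type*} [Group G] (X : Set G) (φ h : G → ℤ) :
    ∃ I : FreeGroup X → G → ℤ, IsWordIntegral φ h I := by
  -- The letters act on `G × ℤ` from the right, the second coordinate accumulating the integral.
  let e : X → Equiv.Perm (G × ℤ) := fun x =>
    { toFun := fun p => (p.1 * x, p.2 + edgeForm φ h p.1 (p.1 * x))
      invFun := fun p => (p.1 * (x : G)⁻¹, p.2 - edgeForm φ h (p.1 * (x : G)⁻¹) p.1)
      left_inv := fun p => by simp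
      right_inv := fun p => by simp }
  let Φ : FreeGroup X →* (Equiv.Perm (G × ℤ))ᵐᵒᵖ := FreeGroup.lift fun x => MulOpposite.op (e x)
  have hmul : ∀ w w' p, (Φ (w * w')).unop p = (Φ w').unop ((Φ w).unop p) := fun w w' p => by simp
  have hof : ∀ x p, (Φ (.of x)).unop p = (p.1 * x, p.2 + edgeForm φ h p.1 (p.1 * x)) :=
    fun x p => by simp [Φ, e]
  have hinv : ∀ x p, (Φ (.of x)⁻¹).unop p =
      (p.1 * (x : G)⁻¹, p.2 - edgeForm φ h (p.1 * (x : G)⁻¹) p.1) := fun x p => by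
    simp only [Φ, map_inv, FreeGroup.lift_apply_of, MulOpposite.unop_inv, MulOpposite.unop_op]
    rfl
  have key : ∀ w p, (Φ w).unop p = (p.1 * wordEval X w, p.2 + ((Φ w).unop (p.1, 0)).2) := by
    intro w
    obtain ⟨n, hn⟩ := HasLength.exists_hasLength w
    refine HasLength.induction (P := fun w _ => ∀ p, (Φ w).unop p =
      (p.1 * wordEval X w, p.2 + ((Φ w).unop (p.1, 0)).2)) (fun _ p => by simp)
      (fun a w _ ih p => ?_) (fun a w _ ih p => ?_) hn
    · rw [hmul, hmul, hof, hof, ih, ih (p.1 * a, 0 + _)]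
      simp [wordEval, mul_assoc, add_assoc]
    · rw [hmul, hmul, hinv, hinv, ih, ih (p.1 * (a : G)⁻¹, 0 - _)]
      simp [wordEval, mul_assoc, sub_eq_add_neg, add_assoc]
  refine ⟨fun w g => ((Φ w).unop (g, 0)).2, fun w w' g => ?_, fun x g => by simp [hof]⟩
  rw [hmul, key w, key w']

namespace IsWordIntegral

variable {G : Type*} [Group G] {X : Set G} {φ h : G → ℤ} {I : FreeGroup X → G → ℤ}

theorem one (hI : IsWordIntegral φ h I) (g : G) : I 1 g = 0 := by
  have := hI.mul 1 1 g
  rw [map_one, mul_one, mul_one] at this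
  omega

theorem inv (hI : IsWordIntegral φ h I) (w : FreeGroup X) (g : G) :
    I w⁻¹ g = -I w (g * (wordEval X w)⁻¹) := by
  have := hI.mul w⁻¹ w g
  rw [inv_mul_cancel, hI.one, map_inv] at this
  omega

theorem inv_of (hI : IsWordIntegral φ h I) (x : X) (g : G) :
    I (FreeGroup.of x)⁻¹ g = edgeForm φ h g (g * (x : G)⁻¹) := by
  rw [hI.inv, wordEval, FreeGroup.lift_apply_of, hI.of, inv_mul_cancel_right]
  simp only [edgeForm]
  ring

/-- A walk in the Cayley graph reads a word. -/
theorem exists_word (hI : IsWordIntegral φ h I) (hX : Subgroup.closure X = ⊤) {a b : G} {n : ℕ}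
    {s : ℤ} (w : WalkInt (wordDist X) φ h a b n s) :
    ∃ u : FreeGroup X, HasLength u n ∧ a * wordEval X u = b ∧ I u a = s := by
  induction w with
  | nil a n => exact ⟨1, .one _, by simp, hI.one a⟩
  | cons hab w ih =>
    obtain ⟨u, hu, rfl, rfl⟩ := ih
    rw [add_comm]
    rcases eq_or_mul_eq_of_wordDist_le_one hX hab with rfl | ⟨x, rfl | hx⟩
    · exact ⟨u, hu.mono (by omega), rfl, by simp⟩
    · refine ⟨.of x * u, (HasLength.of x).mul hu, by simp [wordEval, mul_assoc], ?_⟩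
      rw [hI.mul, hI.of]
      simp [wordEval, edgeForm]
    · obtain rfl := eq_mul_inv_of_mul_eq hx
      refine ⟨(.of x)⁻¹ * u, (HasLength.of x).inv.mul hu, by simp [wordEval, mul_assoc], ?_⟩
      rw [hI.mul, hI.inv_of]
      simp [wordEval, edgeForm]

/-- Up to the exact form `2 c dh`, the integral along a path that stays in the region where `φ` is
within `N` of `c` is bounded by `2 N` times the length. -/
theorem abs_sub_le (hI : IsWordIntegral φ h I) (hX : Subgroup.closure X = ⊤)
    (hφ : IsLip (wordDist X) φ) (hh : IsLip (wordDist X) h) {u : FreeGroup X} {n : ℕ}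
    (hu : HasLength u n) (c : ℤ) (N : ℕ) (g : G) (hg : |φ g - c| + n ≤ N) :
    |I u g - 2 * c * (h (g * wordEval X u) - h g)| ≤ 2 * N * n := by
  have hd := isDiscreteGeodesic_wordDist hX
  have edge : ∀ (g g' : G) (n : ℕ), wordDist X g g' ≤ 1 → |φ g - c| + (n + 1 : ℕ) ≤ N →
      |φ g' - c| + n ≤ N ∧ |edgeForm φ h g g' - 2 * c * (h g' - h g)| ≤ 2 * N := by
    intro g g' n hgg hg
    have h1 := hφ g g'
    have h2 := hφ g' g
    have h3 := hh g g'
    have h4 := hh g' g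
    rw [hd.symm g' g] at h2 h4
    have hgg' : (wordDist X g g' : ℤ) ≤ 1 := by exact_mod_cast hgg
    have h5 : |φ g' - c| ≤ |φ g - c| + 1 := abs_le.2
      ⟨by linarith [neg_abs_le (φ g - c)], by linarith [le_abs_self (φ g - c)]⟩
    push_cast at hg
    refine ⟨by linarith, ?_⟩
    rw [edgeForm, show (φ g + φ g') * (h g' - h g) - 2 * c * (h g' - h g) =
      ((φ g - c) + (φ g' - c)) * (h g' - h g) by ring, abs_mul]
    have h6 : |h g' - h g| ≤ 1 := abs_le.2 ⟨by linarith, by linarith⟩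
    have h7 : |(φ g - c) + (φ g' - c)| ≤ 2 * N := (abs_add_le _ _).trans (by linarith)
    calc _ ≤ 2 * (N : ℤ) * 1 := mul_le_mul h7 h6 (abs_nonneg _) (by positivity)
      _ = _ := mul_one _
  have combine : ∀ (A B p q r : ℤ) (n : ℕ), |A - 2 * c * (q - p)| ≤ 2 * N →
      |B - 2 * c * (r - q)| ≤ 2 * N * n → |A + B - 2 * c * (r - p)| ≤ 2 * N * (n + 1 : ℕ) := by
    intro A B p q r n h1 h2
    have h3 := abs_add_le (A - 2 * c * (q - p)) (B - 2 * c * (r - q))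
    rw [show A + B - 2 * c * (r - p) = A - 2 * c * (q - p) + (B - 2 * c * (r - q)) by ring]
    push_cast
    linarith
  refine HasLength.induction (P := fun u n => ∀ g, |φ g - c| + n ≤ N →
    |I u g - 2 * c * (h (g * wordEval X u) - h g)| ≤ 2 * N * n) (fun n g _ => ?_)
    (fun a u n ih g hg => ?_) (fun a u n ih g hg => ?_) hu g hg
  · rw [hI.one]
    simp only [map_one, mul_one, sub_self, mul_zero, abs_zero]
    positivity
  · have ha : wordEval X (.of a) = (a : G) := by simp [wordEval]
    obtain ⟨h1, h2⟩ := edge g (g * a) n (wordDist_mul_le_one g a) hg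
    rw [hI.mul, hI.of, map_mul, ha, ← mul_assoc]
    exact combine _ _ _ _ _ n h2 (ih _ h1)
  · have ha : wordEval X (.of a) = (a : G) := by simp [wordEval]
    have h0 := wordDist_mul_le_one (g * (a : G)⁻¹) a
    rw [inv_mul_cancel_right, hd.symm] at h0
    obtain ⟨h1, h2⟩ := edge g (g * (a : G)⁻¹) n h0 hg
    rw [hI.mul, hI.inv_of, map_mul, map_inv, ha, ← mul_assoc]
    exact combine _ _ _ _ _ n h2 (ih _ h1)

theorem abs_relator_le (hI : IsWordIntegral φ h I) (hX : Subgroup.closure X = ⊤)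
    (hφ : IsLip (wordDist X) φ) (hh : IsLip (wordDist X) h) {r : FreeGroup X} {ρ : ℕ}
    (hr : r ∈ shortRelators X ρ) (g : G) : |I r g| ≤ 2 * ρ ^ 2 := by
  obtain ⟨hr, hr1⟩ := mem_shortRelators.1 hr
  have := hI.abs_sub_le hX hφ hh hr (φ g) ρ g (by simp)
  rw [hr1, mul_one, sub_self, mul_zero, sub_zero] at this
  linarith

theorem conj (hI : IsWordIntegral φ h I) {r : FreeGroup X} (hr : wordEval X r = 1)
    (f : FreeGroup X) (g : G) : I (f⁻¹ * r * f) g = I r (g * (wordEval X f)⁻¹) := by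
  rw [hI.mul, hI.mul, hI.inv, map_mul, hr, map_inv, mul_one]
  ring

/-- Stokes' theorem: the integral around a loop is bounded by its area. -/
theorem abs_le_area (hI : IsWordIntegral φ h I) (hX : Subgroup.closure X = ⊤)
    (hφ : IsLip (wordDist X) φ) (hh : IsLip (wordDist X) h) {w : FreeGroup X} {ρ l : ℕ}
    (hw : IsProdOfConj (shortRelators X ρ) l w) (g : G) : |I w g| ≤ 2 * ρ ^ 2 * l := by
  obtain ⟨P, rfl, rfl, hP⟩ := hw
  have factor : ∀ p ∈ P, wordEval X p = 1 ∧ ∀ g, |I p g| ≤ 2 * ρ ^ 2 := by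
    intro p hp
    obtain ⟨f, r, hr, rfl | rfl⟩ := hP p hp
    · have hr1 := (mem_shortRelators.1 hr).2
      exact ⟨by simp [hr1], fun g => by
        rw [hI.conj hr1]; exact hI.abs_relator_le hX hφ hh hr _⟩
    · have hr1 := (mem_shortRelators.1 hr).2
      exact ⟨by simp [hr1], fun g => by
        rw [hI.conj (by simp [hr1]), hI.inv, abs_neg]; exact hI.abs_relator_le hX hφ hh hr _⟩
  clear hP
  induction P with
  | nil => simp [hI.one]
  | cons p P ih =>
    obtain ⟨hp, hp'⟩ := factor p (by simp)
    have h1 := ih fun q hq => factor q (by simp [hq])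
    rw [List.prod_cons, hI.mul, hp, mul_one, List.length_cons]
    refine (abs_add_le _ _).trans ?_
    have := hp' g
    push_cast
    linarith

end IsWordIntegral

/-- A linear isoperimetric inequality bounds integrals of `φ dh` around closed walks. -/
theorem linearStokes_of_isoperimetric {G : Type*} [Group G] {X : Set G}
    (hX : Subgroup.closure X = ⊤) {ρ A : ℕ}
    (h : ∀ n w, HasLength w n → wordEval X w = 1 →
      ∃ l ≤ A * (n + 1), IsProdOfConj (shortRelators X ρ) l w) :
    LinearStokes (wordDist X) (2 * ρ ^ 2 * A) := by
  intro φ f hφ hf a n s w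
  obtain ⟨I, hI⟩ := exists_isWordIntegral X φ f
  obtain ⟨u, hu, hua, rfl⟩ := hI.exists_word hX w
  obtain ⟨l, hl, hprod⟩ := h n u hu (by simpa using hua)
  refine (hI.abs_le_area hX hφ hf hprod a).trans ?_
  have hl' : (l : ℤ) ≤ A * (n + 1) := by exact_mod_cast hl
  have := mul_le_mul_of_nonneg_left hl' (show (0 : ℤ) ≤ 2 * ρ ^ 2 by positivity)
  push_cast
  linarith

/-! ### Finite presentations and the spectrum -/

/-- In a finitely presented group, all relations among the elements of a given finite generating set
follow from those of bounded length. -/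
theorem exists_ker_le_normalClosure {G : Type*} [Group G] [hG : Group.IsFinitelyPresented G]
    {X : Set G} (hX : X.Finite) (hgen : Subgroup.closure X = ⊤) :
    ∃ k, 1 ≤ k ∧ (wordEval X).ker ≤ Subgroup.normalClosure (shortRelators X k) := by
  have : Finite X := hX
  obtain ⟨n, φ, hφ, S, hS, hSφ⟩ := hG.out
  choose a ha using fun i => wordEval_surjective hgen (φ (.of i))
  choose b hb using fun x : X => hφ x
  set α : FreeGroup (Fin n) →* FreeGroup X := FreeGroup.lift a with hα
  set β : FreeGroup X →* FreeGroup (Fin n) := FreeGroup.lift b with hβ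
  have hα' : ∀ w, wordEval X (α w) = φ w := fun w => by
    have : (wordEval X).comp α = φ := by
      ext i
      simp [hα, ha]
    exact DFunLike.congr_fun this w
  have hβ' : ∀ w, φ (β w) = wordEval X w := fun w => by
    have : φ.comp β = wordEval X := by
      ext x
      simp [hβ, hb, wordEval]
    exact DFunLike.congr_fun this w
  choose len hlen using fun w : FreeGroup X => HasLength.exists_hasLength w
  obtain ⟨k₁, hk₁⟩ := (hS.image fun r => len (α r)).bddAbove
  obtain ⟨k₂, hk₂⟩ := (Set.finite_range fun x : X => len (α (β (.of x)) * (.of x)⁻¹)).bddAbove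
  refine ⟨k₁ + k₂ + 1, by omega, fun w hw => ?_⟩
  set N := Subgroup.normalClosure (shortRelators X (k₁ + k₂ + 1)) with hN
  have h1 : α (β w) ∈ N := by
    have hle : Subgroup.normalClosure S ≤ N.comap α := by
      refine Subgroup.normalClosure_le_normal fun r hr => Subgroup.subset_normalClosure ?_
      refine mem_shortRelators.2 ⟨(hlen _).mono ?_, ?_⟩
      · exact (hk₁ (Set.mem_image_of_mem _ hr)).trans (by omega)
      · have : r ∈ φ.ker := hSφ ▸ Subgroup.subset_normalClosure hr
        rw [hα']
        exact this
    refine hle ?_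
    rw [hSφ, MonoidHom.mem_ker, hβ']
    exact hw
  have h2 : (QuotientGroup.mk' N).comp (α.comp β) = QuotientGroup.mk' N := by
    ext x
    refine QuotientGroup.eq_iff_div_mem.2 (Subgroup.subset_normalClosure ?_)
    rw [div_eq_mul_inv]
    refine mem_shortRelators.2 ⟨(hlen _).mono ?_, ?_⟩
    · exact (hk₂ ⟨x, rfl⟩).trans (by omega)
    · rw [map_mul, MonoidHom.comp_apply, hα', hβ', map_inv, mul_inv_cancel]
  have h3 := DFunLike.congr_fun h2 w
  rw [← QuotientGroup.eq_one_iff] at h1 ⊢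
  exact h3.symm.trans h1

section Spectrum

variable {G : Type*} [Group G] {X : Set G}

theorem isoSpectrum_le {k m n : ℕ} {B : ℝ}
    (h : ∀ w, HasLength w n → wordEval X w = 1 →
      ∃ l : ℕ, (l : ℝ) ≤ B ∧ IsProdOfConj (shortRelators X m) l w) :
    isoSpectrum X k m n ≤ B := by
  have hne : (areaSet X k m n).Nonempty := ⟨_, [], Nat.zero_le n, one_mem _, rfl⟩
  obtain ⟨l₀, hl₀, -⟩ := h 1 (.one n) (map_one _)
  have hB : 0 ≤ B := (Nat.cast_nonneg l₀).trans hl₀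
  have hker : Subgroup.normalClosure (shortRelators X k) ≤ (wordEval X).ker :=
    Subgroup.normalClosure_le_normal fun r hr => (mem_shortRelators.1 hr).2
  refine (Nat.le_floor_iff hB).1 (csSup_le hne ?_)
  rintro a ⟨L, hL, hmem, rfl⟩
  obtain ⟨l, hl, hprod⟩ := h _ ⟨L, hL, rfl⟩ (hker hmem)
  exact (Nat.sInf_le hprod).trans ((Nat.le_floor_iff hB).2 hl)

theorem exists_isProdOfConj_le_isoSpectrum (hX : X.Finite) {k m n : ℕ} (hkm : k ≤ m)
    {w : FreeGroup X} (hw : HasLength w n)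
    (hmem : w ∈ Subgroup.normalClosure (shortRelators X k)) :
    ∃ l : ℕ, (l : ℝ) ≤ isoSpectrum X k m n ∧ IsProdOfConj (shortRelators X m) l w := by
  obtain ⟨L, hL, rfl⟩ := hw
  refine ⟨_, ?_, isProdOfConj_relArea X hkm hmem⟩
  exact Nat.cast_le.2 ((isoSpectrum_isGreatest hX k m n).2 ⟨L, hL, hmem, rfl⟩)

theorem IsHyperbolicGroup.specEquiv (hG : IsHyperbolicGroup G) (hX : X.Finite)
    (hgen : Subgroup.closure X = ⊤) :
    SpecEquiv (isoSpectrum X) (fun _ m n => (n : ℝ) / (m : ℝ)) := by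
  refine ⟨?_, 1, le_rfl, fun k m n _ _ _ => ?_⟩
  · obtain ⟨C, hC, h⟩ := hG.exists_isProdOfConj hX hgen
    refine ⟨C, hC, fun k m n hk hn hm => isoSpectrum_le fun w hw hw1 => ?_⟩
    have hCm : C ≤ m := (Nat.le_mul_of_pos_right C hk).trans hm
    obtain ⟨l, hl, hprod⟩ := h m n w hCm hw hw1
    refine ⟨l, ?_, hprod⟩
    have hm0 : (0 : ℝ) < m := by exact_mod_cast hC.trans hCm
    have hl' : (l : ℝ) * m ≤ C * (n + m) := by exact_mod_cast hl
    have h1 : (l : ℝ) ≤ C * (n / m) + C := by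
      rw [← mul_le_mul_iff_left₀ hm0]
      refine hl'.trans (le_of_eq ?_)
      field_simp
    have h2 : (0 : ℝ) ≤ C * (((C * n : ℕ) : ℝ) / m) := by positivity
    linarith
  · have h1 : (0 : ℝ) ≤ isoSpectrum X (1 * k) m (1 * n) := Nat.cast_nonneg _
    simp only [one_mul, Nat.cast_one] at h1 ⊢
    linarith

/-- A spectrum of the form `α(n) / m` is at most linear: words of length `n` have area at most `1`
with respect to relators of length `n`, whence `α` grows at most linearly. -/
theorem le_of_specLE {α : ℕ → ℕ}
    (h : SpecLE (fun _ m n => (α n : ℝ) / (m : ℝ)) (isoSpectrum X)) :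
    ∃ A : ℕ, ∀ n, 1 ≤ n → α n ≤ A * n := by
  obtain ⟨C, hC, h⟩ := h
  refine ⟨3 * C ^ 3, fun n hn => ?_⟩
  have h1 := h 1 (C * n) n le_rfl hn (Nat.mul_le_mul_left C hn)
  have h2 : isoSpectrum X (C * 1) (C * n) (C * n) ≤ 1 := isoSpectrum_le fun w hw hw1 =>
    ⟨1, by simp, .of_mem (mem_shortRelators.2 ⟨hw, hw1⟩)⟩
  have hC0 : (1 : ℝ) ≤ C := by exact_mod_cast hC
  have hn0 : (1 : ℝ) ≤ n := by exact_mod_cast hn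
  have h3 : (n : ℝ) / (C * n : ℕ) ≤ 1 := by
    rw [div_le_one (by positivity)]
    push_cast
    nlinarith
  have h4 : (α n : ℝ) / (C * (C * n) : ℕ) ≤ 3 * C := by nlinarith
  rw [div_le_iff₀ (by positivity)] at h4
  have h5 : (α n : ℝ) ≤ (3 * C ^ 3 * n : ℕ) := by
    refine h4.trans (le_of_eq ?_)
    push_cast
    ring
  exact_mod_cast h5

theorem isHyperbolicGroup_of_specEquiv [Group.IsFinitelyPresented G] (hX : X.Finite)
    (hgen : Subgroup.closure X = ⊤) {α : ℕ → ℕ}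
    (h : SpecEquiv (isoSpectrum X) (fun _ m n => (α n : ℝ) / (m : ℝ))) : IsHyperbolicGroup G := by
  obtain ⟨A, hA⟩ := le_of_specLE h.2
  obtain ⟨C, hC, hle⟩ := h.1
  obtain ⟨k, hk, hker⟩ := exists_ker_le_normalClosure hX hgen
  -- At the scale `m = C k` the spectrum gives an ordinary linear isoperimetric inequality.
  have iso : ∀ n w, HasLength w n → wordEval X w = 1 →
      ∃ l ≤ 2 * (C * (A * C) + C) * (n + 1),
        IsProdOfConj (shortRelators X (C * (C * k))) l w := by
    intro n w hw hw1
    have hCk : k ≤ C * (C * k) :=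
      (Nat.le_mul_of_pos_left k hC).trans (Nat.le_mul_of_pos_left _ hC)
    obtain ⟨l, hl, hprod⟩ := exists_isProdOfConj_le_isoSpectrum hX hCk (hw.mono n.le_succ)
      (hker hw1)
    refine ⟨l, ?_, hprod⟩
    have h1 := hl.trans (hle k (C * k) (n + 1) hk (by omega) le_rfl)
    have hm : (1 : ℝ) ≤ (C * k : ℕ) := by exact_mod_cast Nat.mul_le_mul hC hk
    have h2 : (α (C * (n + 1)) : ℝ) / (C * k : ℕ) ≤ A * (C * (n + 1)) :=
      (div_le_self (Nat.cast_nonneg _) hm).trans (by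
        exact_mod_cast hA (C * (n + 1)) (Nat.mul_pos hC n.succ_pos))
    have h3 : ((n + 1 : ℕ) : ℝ) / (C * k : ℕ) ≤ n + 1 :=
      (div_le_self (Nat.cast_nonneg _) hm).trans (by push_cast; rfl)
    have hC0 : (0 : ℝ) ≤ C := Nat.cast_nonneg C
    have h4 := mul_le_mul_of_nonneg_left h2 hC0
    have h5 := mul_le_mul_of_nonneg_left h3 hC0
    have h6 : (0 : ℝ) ≤ C * (A * (C * (n + 1))) := by positivity
    have h7 : (0 : ℝ) ≤ C * n := by positivity
    have h8 : (l : ℝ) ≤ 2 * (C * (A * C) + C) * (n + 1) := by nlinarith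
    exact_mod_cast h8
  have hd := isDiscreteGeodesic_wordDist hgen
  have thin := (linearStokes_of_isoperimetric hgen iso).thinUpTo hd
  exact (fourPoint_of_thin hd thin).isHyperbolicGroup hX hgen

end Spectrum

theorem corollary1p6 (G : Type*) [Group G] [Group.IsFinitelyPresented G]
    (X : Set G) (hX : X.Finite) (hgen : Subgroup.closure X = ⊤) :
    (IsHyperbolicGroup G ↔
      SpecEquiv (isoSpectrum X) (fun _ m n => (n : ℝ) / (m : ℝ))) ∧
    ((∃ α : ℕ → ℕ, SpecEquiv (isoSpectrum X) (fun _ m n => (α n : ℝ) / (m : ℝ))) ↔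
      IsHyperbolicGroup G) :=
  ⟨⟨fun h => h.specEquiv hX hgen, fun h => isHyperbolicGroup_of_specEquiv (α := id) hX hgen h⟩,
    fun ⟨_, h⟩ => isHyperbolicGroup_of_specEquiv hX hgen h, fun h => ⟨id, h.specEquiv hX hgen⟩⟩
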